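/- **Theorem 3.5.** Let $T:\mathbb N\to\mathbb R$ satisfy $T(n)=o(2^{n/2})$ as $n\to\infty$. Let $A:\{0,1\}^*\to\{0,1\}$ be a uniformly random oracle, i.e. the answers $A(w)$, $w\in\{0,1\}^*$, are independent fair bits. Then, with probability $1$, $$\mathbf{NP}^A\not\subseteq \mathrm{BQTime}(T(n))^A .$$ A witness is the following language. View $A$ as the length-preserving function on $\{0,1\}^*$ (again denoted by $A$) whose value at $x$ has as its $i$-th bit ($0\le i<|x|$) the oracle's answer on the pair $(x,i)$, encoded as the string $1^i0x$; then, with probability $1$, the language $\mathcal L_A=\{y:\exists x\ A(x)=y\}$ belongs to $\mathbf{NP}^A$ but not to $\mathrm{BQTime}(T(n))^A$. Here the classes are defined as follows. *Machines.* All machines have a two-way infinite tape with finitely many tracks over $\{0,1,\text{blank}\}$, among them an input, a query and an output track, and one head that moves one cell left or right in each transition other than an oracle call. Initially all tracks are blank except that the input is written on the input track to the right of the start cell, where the head is. There are a pre-query and a post-query state. In the pre-query state the oracle is called in one step: if the non-blank part of the query track is the string $x\circ b$ with $b$ a single bit, then it is replaced by $x\circ(b\oplus A(x))$, if the query track is empty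 nothing is written, and in both cases control passes to the post-query state and nothing else changes. *$\mathbf{NP}^A$* is the class of languages $L\subseteq\{0,1\}^*$ for which there are a nondeterministic oracle machine of this kind and a polynomial $p$ such that, with oracle $A$, each $x\in L$ has an accepting computation of at most $p(|x|)$ steps and no $x\notin L$ has an accepting computation. *$\mathrm{BQTime}(T(n))^A$* is the class of languages $L\subseteq\{0,1\}^*$ for which there is an oracle quantum Turing machine $M$ (transition amplitudes are complex numbers whose real and imaginary parts can be approximated to within $2^{-n}$ in time polynomial in $n$) such that - $M$ is well-formed (its time evolution preserves Euclidean length) and in normal form (from the final state it goes to the initial state, leaving the scanned symbol unchanged and moving right); - on each input $x$, $M$ with oracle $A$ halts with some running time $t\le T(|x|)$: at time $t$ its superposition contains only final configurations, and at no earlier time does it contain one; at all times up to $t$ the non-blank cells of the query track form a single (possibly empty) block, and at time $t$ the head is on the start cell in all configurations; - observing the superposition at time $t$ yields a $1$ in the start cell of the output track with probability at least $2/3$ if $x\in L$, and something else there with probability at least $2/3$ if $x\notin L$. -/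

import Mathlib

open Asymptotics Filter MeasureTheory

noncomputable section

namespace OracleQuantum

/-! ### Oracles and random oracles -/

/-- A Boolean oracle: a function from binary strings to bits. -/
abbrev Oracle : Type := List Bool → Bool

/-- The law of a uniformly random oracle: the answers on the different strings are
independent fair bits. -/
def randomOracle : Measure Oracle :=
  Measure.infinitePi fun _ : List Bool => (PMF.uniformOfFintype Bool).toMeasure

/-- The pair of a string `x` and an index `i`, encoded as the binary string `1^i 0 x`. -/
def pairCode (x : List Bool) (i : ℕ) : List Bool := List.replicate i true ++ false :: x

/-- The length-preserving function given by an oracle: bit number `i` of the value at `x` is the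
answer of the oracle on the pair of `x` and `i` (for `i = 0, …, |x| - 1`). -/
def lengthPreserving (A : Oracle) (x : List Bool) : List Bool :=
  (List.range x.length).map fun i => A (pairCode x i)

/-- The range of the length-preserving function given by the oracle. -/
def rangeLanguage (A : Oracle) : Language Bool := {y | ∃ x, lengthPreserving A x = y}

/-! ### Tapes and configurations

All machines have a two-way infinite tape that is divided into finitely many tracks, and one head.
Each track has the alphabet `0`, `1`, blank. -/

/-- The content of one cell of one track. -/
inductive Cell : Type
  | blank : Cell
  | bit (b : Bool) : Cell
  deriving DecidableEq, Fintype

/-- The blank plays the role of zero, so that tapes with finitely many non-blank cells are finitely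
supported functions. -/
instance : Zero Cell := ⟨Cell.blank⟩

/-- A direction in which the head moves. -/
inductive Move : Type
  | left : Move
  | right : Move
  deriving DecidableEq

instance : Fintype Move where
  elems := {Move.left, Move.right}
  complete d := by cases d <;> simp

/-- The displacement of the head. -/
def Move.shift : Move → ℤ
  | .left => -1
  | .right => 1

/-- The symbols of a tape with `k + 3` tracks: the input track (number `0`), the query track
(number `1`), `k` further work tracks, and the output track (the last one). -/
abbrev Sym (k : ℕ) : Type := Fin (k + 3) → Cell

/-- The track that contains the word `w`, written from cell `p` to the right, and is blank
elsewhere. -/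
def block (p : ℤ) (w : List Bool) (i : ℤ) : Cell :=
  if p ≤ i then
    match w[(i - p).toNat]? with
    | some b => Cell.bit b
    | none => Cell.blank
  else Cell.blank

/-- Configurations of a machine with `s` internal states and `k + 3` tracks. -/
@[ext]
structure Config (k s : ℕ) : Type where
  state : Fin s
  head : ℤ
  tape : ℤ →₀ Sym k

namespace Config

variable {k s : ℕ}

/-- The content of one track. -/
def track (c : Config k s) (j : Fin (k + 3)) (i : ℤ) : Cell := c.tape i j

/-- The scanned symbol. -/
def scanned (c : Config k s) : Sym k := c.tape c.head

/-- Write `σ` in the scanned cell, enter the state `q`, and move the head in direction `d`. -/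
def act (c : Config k s) (σ : Sym k) (q : Fin s) (d : Move) : Config k s where
  state := q
  head := c.head + d.shift
  tape := c.tape.update c.head σ

/-- The initial configuration on input `x`: the head is on cell `0` (the start cell), the input is
on the input track to the right of the start cell, everything else is blank. -/
def init (k : ℕ) {s : ℕ} (start : Fin s) (x : List Bool) : Config k s where
  state := start
  head := 0
  tape := Finsupp.onFinset (Finset.Ico 0 (x.length : ℤ))
    (fun i => Function.update (0 : Sym k) 0 (block 0 x i)) (by
      intro i hi
      by_contra hmem
      apply hi
      have hblock : block 0 x i = 0 := by
        unfold block
        split_ifs with h0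
        · have hlen : x.length ≤ (i - 0).toNat := by
            simp only [Finset.mem_Ico, not_and, not_lt] at hmem
            have := hmem h0
            omega
          rw [List.getElem?_eq_none hlen]
          rfl
        · rfl
      rw [hblock]
      exact Function.update_eq_self (0 : Fin (k + 3)) (0 : Sym k))

/-- The query track is blank except for a single block of non-blank cells (possibly empty). -/
def QueryContiguous (c : Config k s) : Prop := ∃ p w, c.track 1 = block p w

open scoped Classical in
/-- The effect of an oracle call. If the query track holds `x ∘ b` (the string `x` followed by
the target bit `b`), then `b` is replaced by `b ⊕ A(x)`; the block, and hence `p`, `x` and `b`,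
are determined by the track. If the query track is empty, nothing is written (for definiteness
this is also done if the non-blank cells of the query track are not contiguous). In any case
control passes to the state `post`, and nothing else changes. -/
def query (A : Oracle) (post : Fin s) (c : Config k s) : Config k s where
  state := post
  head := c.head
  tape :=
    if h : ∃ u : ℤ × List Bool × Bool, c.track 1 = block u.1 (u.2.1 ++ [u.2.2]) then
      let p := h.choose.1
      let x := h.choose.2.1
      let b := h.choose.2.2
      let target : ℤ := p + x.length
      c.tape.update target (Function.update (c.tape target) 1 (Cell.bit (xor b (A x))))
    else c.tape

end Config

/-! ### Classical oracle Turing machines and NP -/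

/-- A nondeterministic oracle Turing machine: internal states, among them a start state, a
halting (accepting) state, a pre-query and a post-query state, and a transition relation. -/
structure OracleNTM : Type where
  k : ℕ
  s : ℕ
  start : Fin s
  halt : Fin s
  pre : Fin s
  post : Fin s
  δ : Fin s → Sym k → Set (Sym k × Fin s × Move)

namespace OracleNTM

variable (M : OracleNTM)

/-- One step of the machine. The machine stops when it enters the halting state; in the pre-query
state the oracle is called; otherwise one of the possible transitions is carried out. -/
def Step (A : Oracle) (c c' : Config M.k M.s) : Prop :=
  c.state ≠ M.halt ∧
    ((c.state = M.pre ∧ c' = c.query A M.post) ∨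
      (c.state ≠ M.pre ∧ ∃ r ∈ M.δ c.state c.scanned, c' = c.act r.1 r.2.1 r.2.2))

/-- `c'` can be reached from `c` in exactly `t` steps. -/
def ReachesIn (A : Oracle) : ℕ → Config M.k M.s → Config M.k M.s → Prop
  | 0, c, c' => c = c'
  | t + 1, c, c' => ∃ d, M.Step A c d ∧ ReachesIn A t d c'

/-- On input `x` the machine has a computation of exactly `t` steps that ends in the halting
state. -/
def AcceptsIn (A : Oracle) (x : List Bool) (t : ℕ) : Prop :=
  ∃ c, M.ReachesIn A t (Config.init M.k M.start x) c ∧ c.state = M.halt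

/-- There is at most one transition in each situation. -/
def Deterministic : Prop := ∀ q σ, (M.δ q σ).Subsingleton

end OracleNTM

/-- The class NP relative to the oracle `A`: the languages `L` for which there are a
nondeterministic oracle Turing machine and a polynomial `p` such that each `x ∈ L` has an accepting
computation of at most `p(|x|)` steps, and no `x ∉ L` has an accepting computation. -/
def NP (A : Oracle) : Set (Language Bool) :=
  {L | ∃ (M : OracleNTM) (p : Polynomial ℕ),
    (∀ x ∈ L, ∃ t ≤ p.eval x.length, M.AcceptsIn A x t) ∧
    (∀ x ∉ L, ∀ t, ¬ M.AcceptsIn A x t)}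

/-! ### Efficiently approximable amplitudes -/

/-- The integer denoted by a sign bit (`1` for minus) and the binary digits `w` of its absolute
value, the least significant digit first. -/
def signedValue (sgn : Bool) (w : List Bool) : ℤ :=
  (if sgn then -1 else 1) * (Nat.ofDigits 2 (w.map Bool.toNat) : ℕ)

/-- The real numbers that can be approximated to within `2^(-n)` in time polynomial in `n`: there is
a deterministic Turing machine that, given `n` in unary, halts within polynomially many steps with
an integer `m` on its output track such that `m / 2^n` differs from `r` by at most `2^(-n)`. (The
oracle is the constant one, so that oracle calls are of no use.) -/
def PolyTimeReal (r : ℝ) : Prop :=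
  ∃ (M : OracleNTM) (p : Polynomial ℕ), M.Deterministic ∧
    ∀ n : ℕ, ∃ t ≤ p.eval n, ∃ (c : Config M.k M.s) (sgn : Bool) (w : List Bool),
      M.ReachesIn (fun _ => false) t (Config.init M.k M.start (List.replicate n true)) c ∧
      c.state = M.halt ∧
      c.track (Fin.last (M.k + 2)) = block 0 (sgn :: w) ∧
      |r - (signedValue sgn w : ℝ) / 2 ^ n| ≤ 1 / 2 ^ n

/-- The complex numbers whose real and imaginary parts can be approximated to within `2^(-n)` in
time polynomial in `n`. -/
def PolyTimeComplex : Set ℂ := {z | PolyTimeReal z.re ∧ PolyTimeReal z.im}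

/-! ### Oracle quantum Turing machines -/

/-- A superposition of configurations. -/
abbrev Superposition (k s : ℕ) : Type := Config k s →₀ ℂ

/-- The sum of the squared magnitudes. -/
def Superposition.normSq {k s : ℕ} (φ : Superposition k s) : ℝ := φ.sum fun _ a => ‖a‖ ^ 2

open scoped Classical in
/-- The probability of seeing a configuration with the property `P` when `φ` is observed. -/
def Superposition.prob {k s : ℕ} (φ : Superposition k s) (P : Config k s → Prop) : ℝ :=
  ∑ c ∈ φ.support with P c, ‖φ c‖ ^ 2

/-- An oracle quantum Turing machine: internal states, among them an initial and a final state and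
a pre-query and a post-query state, and a quantum transition function. -/
structure OracleQTM : Type where
  k : ℕ
  s : ℕ
  start : Fin s
  final : Fin s
  pre : Fin s
  post : Fin s
  final_ne_start : final ≠ start
  pre_ne_post : pre ≠ post
  pre_ne_final : pre ≠ final
  δ : Fin s → Sym k → (Sym k × Fin s × Move → ℂ)
  δ_mem : ∀ q σ r, δ q σ r ∈ PolyTimeComplex

namespace OracleQTM

variable (M : OracleQTM)

open scoped Classical in
/-- The superposition that results from a single configuration in one step: in the pre-query state
the oracle is called, in every other state the quantum transition function is applied. -/
def stepConfig (A : Oracle) (c : Config M.k M.s) : Superposition M.k M.s :=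
  if c.state = M.pre then Finsupp.single (c.query A M.post) 1
  else ∑ r : Sym M.k × Fin M.s × Move,
    Finsupp.single (c.act r.1 r.2.1 r.2.2) (M.δ c.state c.scanned r)

/-- The time evolution operator with the oracle `A`. -/
def evolve (A : Oracle) : Superposition M.k M.s →ₗ[ℂ] Superposition M.k M.s :=
  Finsupp.linearCombination ℂ (M.stepConfig A)

/-- The superposition at time `t` on input `x`. -/
def run (A : Oracle) (x : List Bool) (t : ℕ) : Superposition M.k M.s :=
  (M.evolve A)^[t] (Finsupp.single (Config.init M.k M.start x) 1)

/-- The machine is well-formed: its time evolution operators preserve Euclidean length. -/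
def WellFormed : Prop :=
  ∀ (A : Oracle) (φ : Superposition M.k M.s), (M.evolve A φ).normSq = φ.normSq

/-- Normal form: the final state leads to the initial state; the scanned cell is left unchanged
and the head moves right. -/
def NormalForm : Prop :=
  ∀ σ, M.δ M.final σ = Pi.single (σ, M.start, Move.right) 1

/-- The machine halts on `x` with running time `t`: at time `t` the superposition contains only final
configurations, and at no earlier time it contains a final configuration. -/
def HaltsAt (A : Oracle) (x : List Bool) (t : ℕ) : Prop :=
  (∀ c ∈ (M.run A x t).support, c.state = M.final) ∧
    ∀ t' < t, ∀ c ∈ (M.run A x t').support, c.state ≠ M.final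

/-- The output track has a `1` in the start cell. -/
def Accepting (c : Config M.k M.s) : Prop := c.track (Fin.last (M.k + 2)) 0 = Cell.bit true

end OracleQTM

/-- The class of languages that are accepted with probability `2/3`, relative to the oracle `A`, by
some oracle quantum Turing machine whose running time on each input of length `n` is at most
`T(n)`. The machine has to be well-formed, in normal form and stationary (in the final superposition
the head is on the start cell), and its query track has to consist of a single block during the
computation. -/
def BQTime (A : Oracle) (T : ℕ → ℝ) : Set (Language Bool) :=
  {L | ∃ M : OracleQTM, M.WellFormed ∧ M.NormalForm ∧
    ∀ x : List Bool, ∃ t : ℕ, (t : ℝ) ≤ T x.length ∧ M.HaltsAt A x t ∧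
      (∀ t' ≤ t, ∀ c ∈ (M.run A x t').support, c.QueryContiguous) ∧
      (∀ c ∈ (M.run A x t).support, c.head = 0) ∧
      (x ∈ L → 2 / 3 ≤ (M.run A x t).prob fun c => M.Accepting c) ∧
      (x ∉ L → 2 / 3 ≤ (M.run A x t).prob fun c => ¬ M.Accepting c)}

end OracleQuantum

end

/-! For the lower bound, fix a well-formed machine and test it on `1^n`, which lies in the range
exactly when some `x` of length `n` has the value `1^n`. For `n ≥ 1` no such `x` exists with
probability `(1 - 2^(-n))^(2^n) ≥ 1/4`. Suppose that the machine then answers correctly after `t ≤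
T(n)` steps. The answers that determine the values at the different `x` form disjoint sets `codes
x`, so the probabilities of querying them, summed over all `x` and all times, add up to at most `t`.
By the hybrid argument, changing the value at `x` to ones moves the run by a squared distance of at
most `4t` times the share of `x`, whereas a correct answer after the change requires a squared
distance of at least `1/18`. Hence at most `72 T(n)^2` changes are noticed, which is at most half of
all `2^n` changes for large `n` (`card_correctOn_forceOnes_le`).

Changing the value at `x` to ones amounts to conditioning on its being ones, an event of probability
`2^(-n)`. So the unnoticed changes sweep out errors of total probability at least half that of the
correct rejections, and the machine errs on `1^n` with probability at least `1/8`. This also holds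
conditionally on any event about shorter queries (`measureReal_inter_le`). Along a sparse sequence
of lengths the factors `7/8` multiply, and the machine is always correct with probability `0`
(`measure_forall_correctOn_eq_zero`). There are only countably many machines, because computable
amplitudes form a countable set, so almost surely none of them decides the language.

Membership in NP holds for every oracle: an explicit machine guesses a preimage and compares its
value with the input bit by bit. An invariant (`Reachable`), which carries a bound on the remaining
steps, yields completeness by `Reachable.progress` and soundness by `Reachable.step`. -/

namespace OracleQuantum

/-! ### Superpositions -/

namespace Superposition

variable {k s : ℕ}

theorem normSq_eq_sum {φ : Superposition k s} {U : Finset (Config k s)} (h : φ.support ⊆ U) :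
    φ.normSq = ∑ c ∈ U, ‖φ c‖ ^ 2 :=
  Finsupp.sum_of_support_subset φ h _ (by simp)

theorem normSq_single (c : Config k s) (z : ℂ) :
    normSq (Finsupp.single c z) = ‖z‖ ^ 2 :=
  Finsupp.sum_single_index (by simp)

/-- Young's inequality for the cross term. Keeping the weight free allows squared norms to be used
throughout: the weight is `1` for one step, `t` in the hybrid induction, and `2` when outcomes are
compared. -/
theorem norm_add_sq_le_weighted {a : ℝ} (ha : 0 < a) (u v : ℂ) :
    ‖u + v‖ ^ 2 ≤ (1 + a⁻¹) * ‖u‖ ^ 2 + (1 + a) * ‖v‖ ^ 2 := by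
  have h1 : ‖u + v‖ ^ 2 ≤ (‖u‖ + ‖v‖) ^ 2 := by gcongr; exact norm_add_le u v
  have h2 : 0 ≤ a⁻¹ * (‖u‖ - a * ‖v‖) ^ 2 := by positivity
  have h3 : a⁻¹ * (‖u‖ - a * ‖v‖) ^ 2
      = a⁻¹ * ‖u‖ ^ 2 + a * ‖v‖ ^ 2 - 2 * ‖u‖ * ‖v‖ := by
    field_simp
    ring
  nlinarith

theorem normSq_add_le {a : ℝ} (ha : 0 < a) (φ ψ : Superposition k s) :
    normSq (φ + ψ) ≤ (1 + a⁻¹) * φ.normSq + (1 + a) * ψ.normSq := by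
  classical
  rw [normSq_eq_sum (Finsupp.support_add (g₁ := φ) (g₂ := ψ)),
    normSq_eq_sum (φ := φ) Finset.subset_union_left,
    normSq_eq_sum (φ := ψ) Finset.subset_union_right, Finset.mul_sum, Finset.mul_sum,
    ← Finset.sum_add_distrib]
  exact Finset.sum_le_sum fun c _ => norm_add_sq_le_weighted ha _ _

theorem normSq_neg (φ : Superposition k s) : normSq (-φ) = φ.normSq := by
  rw [normSq_eq_sum (Finsupp.support_neg φ).subset, normSq_eq_sum subset_rfl]
  simp

open scoped Classical in
theorem prob_eq_normSq_filter (φ : Superposition k s) (P : Config k s → Prop) :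
    φ.prob P = normSq (φ.filter P) := by
  rw [prob, normSq, Finsupp.sum, Finsupp.support_filter]
  refine Finset.sum_congr rfl fun c hc => ?_
  rw [Finsupp.filter_apply_pos P φ (Finset.mem_filter.1 hc).2]

theorem prob_nonneg (φ : Superposition k s) (P : Config k s → Prop) : 0 ≤ φ.prob P :=
  Finset.sum_nonneg fun _ _ => by positivity

theorem prob_le_normSq (φ : Superposition k s) (P : Config k s → Prop) :
    φ.prob P ≤ φ.normSq := by
  classical
  unfold prob normSq Finsupp.sum
  exact Finset.sum_le_sum_of_subset_of_nonneg (Finset.filter_subset _ _)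
    fun _ _ _ => by positivity

open scoped Classical in
theorem prob_add_prob_not (φ : Superposition k s) (P : Config k s → Prop) :
    φ.prob P + φ.prob (fun c => ¬ P c) = φ.normSq := by
  rw [prob, prob, normSq, Finsupp.sum,
    ← Finset.sum_filter_add_sum_filter_not φ.support P fun c => ‖φ c‖ ^ 2]
  congr!

theorem prob_eq_normSq {φ : Superposition k s} {P : Config k s → Prop}
    (h : ∀ c ∈ φ.support, P c) : φ.prob P = φ.normSq := by
  classical
  unfold prob normSq
  rw [Finset.filter_true_of_mem h]
  rfl

theorem prob_eq_zero {φ : Superposition k s} {P : Config k s → Prop}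
    (h : ∀ c ∈ φ.support, ¬ P c) : φ.prob P = 0 := by
  classical
  unfold prob
  rw [Finset.filter_false_of_mem h, Finset.sum_empty]

/-- The probability of an event varies continuously with the superposition. -/
theorem prob_le_weighted {a : ℝ} (ha : 0 < a) (φ ψ : Superposition k s)
    (P : Config k s → Prop) :
    φ.prob P ≤ (1 + a⁻¹) * ψ.prob P + (1 + a) * normSq (φ - ψ) := by
  classical
  have h : φ.filter P = ψ.filter P + (φ - ψ).filter P := by
    rw [← Finsupp.filter_add, add_sub_cancel]
  calc φ.prob P = normSq (ψ.filter P + (φ - ψ).filter P) := by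
        rw [prob_eq_normSq_filter φ P, ← h]
    _ ≤ _ := normSq_add_le ha _ _
    _ ≤ _ := by
        rw [prob_eq_normSq_filter ψ, ← prob_eq_normSq_filter (φ - ψ)]
        gcongr
        exact prob_le_normSq _ _

/-- The probabilities of mutually exclusive events add up to at most one. -/
theorem sum_prob_le_normSq {ι : Type*} (X : Finset ι) (P : ι → Config k s → Prop)
    (hP : ∀ x ∈ X, ∀ x' ∈ X, ∀ c, P x c → P x' c → x = x') (φ : Superposition k s) :
    ∑ x ∈ X, φ.prob (P x) ≤ φ.normSq := by
  classical
  have h1 : ∀ x ∈ X, φ.prob (P x) = ∑ c ∈ φ.support, if P x c then ‖φ c‖ ^ 2 else 0 := by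
    intro x _
    unfold prob
    rw [Finset.sum_filter]
  rw [Finset.sum_congr rfl h1, Finset.sum_comm]
  refine Finset.sum_le_sum fun c _ => ?_
  rw [← Finset.sum_filter, Finset.sum_const, nsmul_eq_mul]
  have h2 : (X.filter fun x => P x c).card ≤ 1 := by
    rw [Finset.card_le_one]
    intro x hx x' hx'
    rw [Finset.mem_filter] at hx hx'
    exact hP x hx.1 x' hx'.1 c hx.2 hx'.2
  have h3 : ((X.filter fun x => P x c).card : ℝ) ≤ 1 := by exact_mod_cast h2
  exact mul_le_of_le_one_left (by positivity) h3

end Superposition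

/-! ### Blocks on a track -/

theorem block_add (p : ℤ) (w : List Bool) (j : ℕ) :
    block p w (p + j) = (w[j]?).elim Cell.blank Cell.bit := by
  unfold block
  rw [if_pos (by omega)]
  have : (p + (j : ℤ) - p).toNat = j := by omega
  rw [this]
  cases w[j]? <;> rfl

theorem block_of_lt {p i : ℤ} (w : List Bool) (h : i < p) : block p w i = Cell.blank := by
  unfold block
  rw [if_neg (by omega)]

theorem block_of_ge {p i : ℤ} {w : List Bool} (h : p + w.length ≤ i) :
    block p w i = Cell.blank := by
  obtain ⟨j, rfl⟩ : ∃ j : ℕ, i = p + j := ⟨(i - p).toNat, by omega⟩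
  rw [block_add, List.getElem?_eq_none (by omega)]
  rfl

theorem block_add_of_lt (p : ℤ) {w : List Bool} {j : ℕ} (h : j < w.length) :
    block p w (p + j) = Cell.bit w[j] := by
  rw [block_add, List.getElem?_eq_getElem h]
  rfl

theorem block_eq_blank_iff {p i : ℤ} {w : List Bool} :
    block p w i = Cell.blank ↔ i < p ∨ p + w.length ≤ i := by
  constructor
  · intro h
    by_contra! hc
    obtain ⟨j, rfl⟩ : ∃ j : ℕ, i = p + j := ⟨(i - p).toNat, by omega⟩
    rw [block_add_of_lt p (by omega)] at h
    cases h
  · rintro (h | h)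
    · exact block_of_lt w h
    · exact block_of_ge h

/-- The non-blank cells reveal the position and the length. An empty block has no position, which is
why `w ≠ []` is required; a query block always contains a target bit. -/
theorem block_injective {p p' : ℤ} {w w' : List Bool} (hw : w ≠ [])
    (h : block p w = block p' w') : p = p' ∧ w = w' := by
  have hlen : 0 < w.length := List.length_pos_iff.2 hw
  have key : ∀ i, (i < p ∨ p + w.length ≤ i) ↔ (i < p' ∨ p' + w'.length ≤ i) := fun i => by
    rw [← block_eq_blank_iff, ← block_eq_blank_iff, h]
  have hp : p = p' := by
    have h1 := key p
    have h2 := key p'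
    omega
  subst hp
  refine ⟨rfl, List.ext_getElem? fun j => ?_⟩
  have hj := congrFun h (p + j)
  rw [block_add, block_add] at hj
  cases h1 : w[j]? <;> cases h2 : w'[j]? <;> simp_all

/-! ### Queries -/

namespace Config

variable {k s : ℕ}

open scoped Classical in
/-- The string about which the oracle is asked in a configuration. -/
noncomputable def queriedWord (c : Config k s) : Option (List Bool) :=
  if h : ∃ u : ℤ × List Bool × Bool, c.track 1 = block u.1 (u.2.1 ++ [u.2.2]) then
    some h.choose.2.1
  else none

theorem query_congr {A B : Oracle} (post : Fin s) (c : Config k s)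
    (h : ∀ w, c.queriedWord = some w → A w = B w) : c.query A post = c.query B post := by
  unfold query
  unfold queriedWord at h
  by_cases hc : ∃ u : ℤ × List Bool × Bool, c.track 1 = block u.1 (u.2.1 ++ [u.2.2])
  · rw [dif_pos hc] at h
    simp only [dif_pos hc, h _ rfl]
  · simp only [dif_neg hc]

/-- The inequality is strict because the target bit occupies one more non-blank cell than the string
itself. -/
theorem length_queriedWord_lt {c : Config k s} {w : List Bool} (h : c.queriedWord = some w) :
    w.length < c.tape.support.card := by
  unfold queriedWord at h
  split_ifs at h with hc
  rw [Option.some_inj] at h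
  have hspec := hc.choose_spec
  rw [h] at hspec
  set p := hc.choose.1
  set b := hc.choose.2.2
  have hsub : (Finset.range (w.length + 1)).image (fun j : ℕ => p + (j : ℤ)) ⊆
      c.tape.support := by
    intro i hi
    obtain ⟨j, hj, rfl⟩ := Finset.mem_image.1 hi
    rw [Finset.mem_range] at hj
    rw [Finsupp.mem_support_iff]
    intro h0
    have h1 : c.track 1 (p + j) = Cell.blank := by
      unfold track
      rw [h0]
      rfl
    rw [hspec, block_add_of_lt p (by simpa using hj)] at h1
    cases h1
  have := Finset.card_le_card hsub
  rw [Finset.card_image_of_injective _ (fun a b hab => by simpa using hab),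
    Finset.card_range] at this
  omega

theorem card_support_update_le (f : ℤ →₀ Sym k) (i : ℤ) (σ : Sym k) :
    (f.update i σ).support.card ≤ f.support.card + 1 := by
  classical
  rw [Finsupp.support_update]
  split_ifs
  · exact (Finset.card_le_card (Finset.erase_subset _ _)).trans (Nat.le_succ _)
  · exact Finset.card_insert_le _ _

theorem card_support_act_le (c : Config k s) (σ : Sym k) (q : Fin s) (d : Move) :
    (c.act σ q d).tape.support.card ≤ c.tape.support.card + 1 :=
  card_support_update_le _ _ _

theorem card_support_query_le (A : Oracle) (post : Fin s) (c : Config k s) :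
    (c.query A post).tape.support.card ≤ c.tape.support.card + 1 := by
  unfold query
  dsimp only
  split_ifs
  · exact card_support_update_le _ _ _
  · exact Nat.le_succ _

theorem card_support_init_le (start : Fin s) (x : List Bool) :
    (init k start x).tape.support.card ≤ x.length := by
  have h : (init k start x).tape.support ⊆ Finset.Ico 0 (x.length : ℤ) := by
    intro i hi
    by_contra hmem
    refine Finsupp.mem_support_iff.1 hi ?_
    have hblock : block 0 x i = Cell.blank := by
      rw [Finset.mem_Ico] at hmem
      rw [block_eq_blank_iff]
      omega
    change Function.update (0 : Sym k) 0 (block 0 x i) = 0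
    rw [hblock]
    exact Function.update_eq_self (0 : Fin (k + 3)) (0 : Sym k)
  simpa using Finset.card_le_card h

end Config

/-! ### Runs of oracle quantum Turing machines -/

namespace OracleQTM

variable (M : OracleQTM)

theorem run_zero (A : Oracle) (x : List Bool) :
    M.run A x 0 = Finsupp.single (Config.init M.k M.start x) 1 := rfl

theorem run_succ (A : Oracle) (x : List Bool) (t : ℕ) :
    M.run A x (t + 1) = M.evolve A (M.run A x t) :=
  Function.iterate_succ_apply' _ _ _

theorem normSq_run {M : OracleQTM} (hM : M.WellFormed) (A : Oracle) (x : List Bool) (t : ℕ) :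
    (M.run A x t).normSq = 1 := by
  induction t with
  | zero =>
    rw [run_zero, Superposition.normSq_single, norm_one, one_pow]
  | succ t ih => rw [run_succ, hM, ih]

theorem stepConfig_congr {A B : Oracle} {c : Config M.k M.s}
    (h : ∀ w, c.queriedWord = some w → A w = B w) : M.stepConfig A c = M.stepConfig B c := by
  unfold stepConfig
  rw [Config.query_congr M.post c h]

theorem evolve_congr {A B : Oracle} {φ : Superposition M.k M.s}
    (h : ∀ c ∈ φ.support, ∀ w, c.queriedWord = some w → A w = B w) :
    M.evolve A φ = M.evolve B φ := by
  unfold evolve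
  rw [Finsupp.linearCombination_apply, Finsupp.linearCombination_apply]
  exact Finsupp.sum_congr fun c hc => by rw [M.stepConfig_congr (h c hc)]

theorem stepConfig_mem_supported (A : Oracle) {c : Config M.k M.s} {m : ℕ}
    (hc : c.tape.support.card ≤ m) :
    M.stepConfig A c ∈
      Finsupp.supported ℂ ℂ {c : Config M.k M.s | c.tape.support.card ≤ m + 1} := by
  unfold stepConfig
  split_ifs
  · exact Finsupp.single_mem_supported ℂ _ ((Config.card_support_query_le A _ c).trans (by omega))
  · exact Submodule.sum_mem _ fun r _ => Finsupp.single_mem_supported ℂ _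
      ((Config.card_support_act_le c _ _ _).trans (by omega))

/-- Every step, oracle calls included, rewrites at most one cell. This bounds the length of the
strings that can be queried, and makes correctness on one input depend on finitely many answers. -/
theorem run_mem_supported (A : Oracle) (x : List Bool) (t : ℕ) :
    M.run A x t ∈
      Finsupp.supported ℂ ℂ {c : Config M.k M.s | c.tape.support.card ≤ x.length + t} := by
  induction t with
  | zero =>
    rw [run_zero, add_zero]
    exact Finsupp.single_mem_supported ℂ _ (Config.card_support_init_le M.start x)
  | succ t ih =>
    rw [run_succ, evolve, Finsupp.linearCombination_apply]
    refine Submodule.sum_mem _ fun c hc => Submodule.smul_mem _ _ ?_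
    exact M.stepConfig_mem_supported A (ih hc)

/-- In `t` steps a machine can only ask about short strings. -/
theorem run_congr {A B : Oracle} (x : List Bool) {t : ℕ}
    (h : ∀ w : List Bool, w.length ≤ x.length + t → A w = B w) : M.run A x t = M.run B x t := by
  induction t with
  | zero => rw [run_zero, run_zero]
  | succ t ih =>
    rw [run_succ, run_succ, ← ih fun w hw => h w (by omega)]
    refine M.evolve_congr fun c hc w hw => h w ?_
    have h1 := Config.length_queriedWord_lt hw
    have h2 : c.tape.support.card ≤ x.length + t := M.run_mem_supported A x t hc
    omega

/-- One step with a changed oracle: the error is controlled by the probability of asking about a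
string where the oracle has been changed. -/
theorem normSq_evolve_sub_le {M : OracleQTM} (hM : M.WellFormed) {A B : Oracle}
    {W : Set (List Bool)} (hAB : ∀ w ∉ W, A w = B w) (φ : Superposition M.k M.s) :
    Superposition.normSq (M.evolve B φ - M.evolve A φ) ≤
      4 * φ.prob fun c => ∃ w ∈ W, c.queriedWord = some w := by
  classical
  set P : Config M.k M.s → Prop := fun c => ∃ w ∈ W, c.queriedWord = some w with hP
  have hsplit := Finsupp.filter_add_filter_not φ P
  -- The part of `φ` that does not query `W` evolves identically under both oracles and cancels. Two
  -- images of the querying part remain, each of squared norm equal to the query probability; weight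
  -- `1` gives the factor `2 + 2 = 4`.
  have hout : M.evolve B (φ.filter fun c => ¬ P c) = M.evolve A (φ.filter fun c => ¬ P c) := by
    refine M.evolve_congr fun c hc w hw => ?_
    rw [Finsupp.support_filter, Finset.mem_filter] at hc
    exact (hAB w fun hwW => hc.2 ⟨w, hwW, hw⟩).symm
  have hdiff : M.evolve B φ - M.evolve A φ =
      M.evolve B (φ.filter P) + -M.evolve A (φ.filter P) := by
    conv_lhs => rw [← hsplit, map_add, map_add, hout]
    rw [add_sub_add_right_eq_sub, sub_eq_add_neg]
  rw [hdiff, Superposition.prob_eq_normSq_filter]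
  refine (Superposition.normSq_add_le one_pos _ _).trans_eq ?_
  rw [Superposition.normSq_neg, hM, hM]
  ring

/-- The hybrid argument: the effect of changing the oracle on a set of strings is controlled by the
probabilities of asking about these strings. -/
theorem normSq_run_sub_le {M : OracleQTM} (hM : M.WellFormed) {A B : Oracle}
    {W : Set (List Bool)} (hAB : ∀ w ∉ W, A w = B w) (x : List Bool) (t : ℕ) :
    Superposition.normSq (M.run B x t - M.run A x t) ≤
      4 * t * ∑ s ∈ Finset.range t,
        (M.run A x s).prob fun c => ∃ w ∈ W, c.queriedWord = some w := by
  induction t with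
  | zero =>
    rw [run_zero, run_zero, sub_self]
    simp [Superposition.normSq]
  | succ t ih =>
    have hstep := normSq_evolve_sub_le hM hAB (M.run A x t)
    rw [run_succ, run_succ, Finset.sum_range_succ]
    set S := ∑ s ∈ Finset.range t,
      (M.run A x s).prob fun c => ∃ w ∈ W, c.queriedWord = some w
    set p := (M.run A x t).prob fun c => ∃ w ∈ W, c.queriedWord = some w
    have hdecomp : M.evolve B (M.run B x t) - M.evolve A (M.run A x t) =
        M.evolve B (M.run B x t - M.run A x t) +
          (M.evolve B (M.run A x t) - M.evolve A (M.run A x t)) := by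
      rw [map_sub, sub_add_sub_cancel]
    rw [hdecomp]
    -- The weight `t` must be positive. It is the choice that turns `4tS` into `4(t+1)S` and
    -- attaches the same factor to the new term, replacing the triangle and Cauchy–Schwarz
    -- inequalities.
    rcases Nat.eq_zero_or_pos t with rfl | ht
    · rw [run_zero, run_zero, sub_self, map_zero, zero_add]
      refine hstep.trans_eq ?_
      simp [S]
    · have ht' : (0 : ℝ) < t := by exact_mod_cast ht
      refine (Superposition.normSq_add_le ht' _ _).trans ?_
      rw [hM]
      calc (1 + (t : ℝ)⁻¹) * Superposition.normSq (M.run B x t - M.run A x t) +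
            (1 + t) * Superposition.normSq (M.evolve B (M.run A x t) - M.evolve A (M.run A x t))
          ≤ (1 + (t : ℝ)⁻¹) * (4 * t * S) + (1 + t) * (4 * p) := by gcongr
        _ = 4 * ((t + 1 : ℕ) : ℝ) * (S + p) := by
            push_cast
            field_simp
            ring

end OracleQTM

/-! ### The blocks of random bits that make up the length-preserving function -/

/-- The prefix `1^i 0` is self-delimiting. This makes the sets `codes x` disjoint, hence the values
at different arguments independent. -/
theorem pairCode_injective {x x' : List Bool} {i i' : ℕ} (h : pairCode x i = pairCode x' i') :
    x = x' ∧ i = i' := by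
  unfold pairCode at h
  induction i generalizing i' with
  | zero =>
    cases i' with
    | zero => simpa using h
    | succ i' => simp [List.replicate_succ] at h
  | succ i ih =>
    cases i' with
    | zero => simp [List.replicate_succ] at h
    | succ i' =>
      rw [List.replicate_succ, List.replicate_succ, List.cons_append, List.cons_append,
        List.cons.injEq] at h
      obtain ⟨h1, h2⟩ := ih h.2
      exact ⟨h1, by rw [h2]⟩

theorem length_pairCode (x : List Bool) (i : ℕ) : (pairCode x i).length = i + x.length + 1 := by
  simp [pairCode]
  omega

/-- The strings about which the oracle has to be asked to compute the value at `x` of the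
length-preserving function. -/
def codes (x : List Bool) : Finset (List Bool) := (Finset.range x.length).image (pairCode x)

theorem mem_codes {x w : List Bool} : w ∈ codes x ↔ ∃ i < x.length, pairCode x i = w := by
  simp [codes]

theorem card_codes (x : List Bool) : (codes x).card = x.length := by
  rw [codes, Finset.card_image_of_injective _ fun i j h => (pairCode_injective h).2,
    Finset.card_range]

theorem eq_of_mem_codes {x x' w : List Bool} (h : w ∈ codes x) (h' : w ∈ codes x') : x = x' := by
  obtain ⟨i, _, rfl⟩ := mem_codes.1 h
  obtain ⟨j, _, hj⟩ := mem_codes.1 h'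
  exact (pairCode_injective hj).1.symm

theorem disjoint_codes {x x' : List Bool} (h : x ≠ x') : Disjoint (codes x) (codes x') :=
  Finset.disjoint_left.2 fun _ hw hw' => h (eq_of_mem_codes hw hw')

theorem length_lt_of_mem_codes {x w : List Bool} (h : w ∈ codes x) : x.length < w.length := by
  obtain ⟨i, _, rfl⟩ := mem_codes.1 h
  rw [length_pairCode]
  omega

theorem length_le_of_mem_codes {x w : List Bool} (h : w ∈ codes x) : w.length ≤ 2 * x.length := by
  obtain ⟨i, hi, rfl⟩ := mem_codes.1 h
  rw [length_pairCode]
  omega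

/-- The value at `x` of the length-preserving function consists of ones. -/
def AllOnes (x : List Bool) (A : Oracle) : Prop := ∀ w ∈ codes x, A w = true

/-- Change the oracle so that the value at `x` consists of ones. -/
def forceOnes (x : List Bool) (A : Oracle) : Oracle := fun w => if w ∈ codes x then true else A w

theorem forceOnes_of_notMem {x w : List Bool} (A : Oracle) (h : w ∉ codes x) :
    forceOnes x A w = A w := if_neg h

theorem allOnes_forceOnes (x : List Bool) (A : Oracle) : AllOnes x (forceOnes x A) :=
  fun _ hw => if_pos hw

theorem forceOnes_eq_self {x : List Bool} {A : Oracle} (h : AllOnes x A) :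
    forceOnes x A = A := by
  funext w
  unfold forceOnes
  split_ifs with hw
  · exact (h w hw).symm
  · rfl

theorem length_lengthPreserving (A : Oracle) (x : List Bool) :
    (lengthPreserving A x).length = x.length := by
  simp [lengthPreserving]

theorem ones_mem_rangeLanguage_iff {A : Oracle} {n : ℕ} :
    List.replicate n true ∈ rangeLanguage A ↔ ∃ x : List Bool, x.length = n ∧ AllOnes x A := by
  have key : ∀ x : List Bool,
      lengthPreserving A x = List.replicate n true ↔ x.length = n ∧ AllOnes x A := by
    intro x
    rw [List.eq_replicate_iff, length_lengthPreserving]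
    refine and_congr_right fun _ => ?_
    simp only [lengthPreserving, AllOnes, List.mem_map, List.mem_range, mem_codes]
    constructor
    · rintro h w ⟨i, hi, rfl⟩
      exact h _ ⟨i, hi, rfl⟩
    · rintro h b ⟨i, hi, rfl⟩
      exact h _ ⟨i, hi, rfl⟩
  exact exists_congr key

/-- The strings of length `n`. -/
noncomputable def strings (n : ℕ) : Finset (List Bool) := (List.finite_length_eq Bool n).toFinset

theorem mem_strings {n : ℕ} {x : List Bool} : x ∈ strings n ↔ x.length = n := by
  simp [strings]

theorem card_strings (n : ℕ) : (strings n).card = 2 ^ n := by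
  have h : strings n = Finset.univ.image (List.ofFn : (Fin n → Bool) → List Bool) := by
    ext x
    rw [mem_strings, Finset.mem_image]
    constructor
    · rintro rfl
      exact ⟨x.get, Finset.mem_univ _, List.ofFn_get x⟩
    · rintro ⟨f, _, rfl⟩
      exact List.length_ofFn
  rw [h, Finset.card_image_of_injective _ List.ofFn_injective, Finset.card_univ]
  simp

/-! ### Deciding the range language -/

namespace OracleQTM

variable (M : OracleQTM)

/-- The machine decides within `T` steps and with error at most `1/3` whether `y` is in the range of
the length-preserving function. -/
def CorrectOn (T : ℝ) (y : List Bool) (A : Oracle) : Prop :=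
  ∃ t : ℕ, (t : ℝ) ≤ T ∧ M.HaltsAt A y t ∧
    (y ∈ rangeLanguage A → 2 / 3 ≤ (M.run A y t).prob fun c => M.Accepting c) ∧
    (y ∉ rangeLanguage A → 2 / 3 ≤ (M.run A y t).prob fun c => ¬ M.Accepting c)

/-- Correctness on `1^n` depends on finitely many answers of the oracle. -/
theorem correctOn_congr {T : ℝ} {n : ℕ} {A B : Oracle}
    (h : ∀ w : List Bool, w.length ≤ 2 * n + ⌊T⌋₊ → A w = B w) :
    M.CorrectOn T (List.replicate n true) A ↔ M.CorrectOn T (List.replicate n true) B := by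
  have hrun : ∀ t : ℕ, (t : ℝ) ≤ T →
      M.run A (List.replicate n true) t = M.run B (List.replicate n true) t := fun t ht =>
    M.run_congr _ fun w hw => h w (by
      have := Nat.le_floor ht
      rw [List.length_replicate] at hw
      omega)
  have hL : List.replicate n true ∈ rangeLanguage A ↔ List.replicate n true ∈ rangeLanguage B := by
    rw [ones_mem_rangeLanguage_iff, ones_mem_rangeLanguage_iff]
    refine exists_congr fun x => and_congr_right fun hx => forall₂_congr fun w hw => ?_
    rw [h w (by have := length_le_of_mem_codes hw; omega)]
  unfold CorrectOn HaltsAt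
  refine exists_congr fun t => and_congr_right fun ht => ?_
  rw [hL, hrun t ht]
  refine and_congr_left fun _ => and_congr_right fun _ => forall₂_congr fun t' ht' => ?_
  rw [hrun t' ((Nat.cast_le.2 ht'.le).trans ht)]

/-- If the machine correctly rejects with one oracle and correctly accepts with another one, then
its runs have drifted apart. -/
theorem exists_le_normSq_run_sub {M : OracleQTM} (hM : M.WellFormed) {A B : Oracle}
    {y : List Bool} {t : ℕ} (hA : M.HaltsAt A y t)
    (hrej : 2 / 3 ≤ (M.run A y t).prob fun c => ¬ M.Accepting c)
    {t' : ℕ} (hB : M.HaltsAt B y t') (hacc : 2 / 3 ≤ (M.run B y t').prob fun c => M.Accepting c) :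
    ∃ m ≤ t, 1 / 18 ≤ Superposition.normSq (M.run B y m - M.run A y m) := by
  -- The halting times may differ, so the runs are compared at the earlier one. If they differ,
  -- being in the final state separates the runs completely and the squared distance is at least
  -- `1/3`. If they agree, weight `2` gives `2/3 ≤ (3/2)(1/3) + 3d`, which is the source of `1/18`.
  rcases lt_trichotomy t t' with h | rfl | h
  · refine ⟨t, le_rfl, ?_⟩
    have h1 := Superposition.prob_le_weighted two_pos (M.run B y t) (M.run A y t)
      fun c => c.state ≠ M.final
    rw [Superposition.prob_eq_normSq (hB.2 t h), normSq_run hM,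
      Superposition.prob_eq_zero fun c hc => not_not.2 (hA.1 c hc)] at h1
    linarith
  · refine ⟨t, le_rfl, ?_⟩
    have h1 := Superposition.prob_le_weighted two_pos (M.run B y t) (M.run A y t)
      fun c => M.Accepting c
    have h2 := Superposition.prob_add_prob_not (M.run A y t) fun c => M.Accepting c
    rw [normSq_run hM] at h2
    norm_num at h1
    linarith
  · refine ⟨t', h.le, ?_⟩
    have h1 := Superposition.prob_le_weighted two_pos (M.run B y t') (M.run A y t')
      fun c => c.state = M.final
    rw [Superposition.prob_eq_normSq hB.1, normSq_run hM,
      Superposition.prob_eq_zero (hA.2 t' h)] at h1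
    linarith

open scoped Classical in
/-- If `1^n` is not in the range and the machine finds this out, then it also gives the wrong answer
on `1^n` after most of the changes that put `1^n` into the range. -/
theorem card_correctOn_forceOnes_le {M : OracleQTM} (hM : M.WellFormed) {A : Oracle} {n : ℕ}
    {T : ℝ} (hA : M.CorrectOn T (List.replicate n true) A)
    (hn : List.replicate n true ∉ rangeLanguage A) :
    (((strings n).filter fun x =>
      M.CorrectOn T (List.replicate n true) (forceOnes x A)).card : ℝ) ≤ 72 * T ^ 2 := by
  obtain ⟨t, ht, hhalt, -, hrej⟩ := hA
  set y := List.replicate n true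
  set S := (strings n).filter fun x => M.CorrectOn T y (forceOnes x A) with hS
  set P : List Bool → Config M.k M.s → Prop :=
    fun x c => ∃ w ∈ (codes x : Set (List Bool)), c.queriedWord = some w with hP
  -- Here `72 = 18 * 4`, from the required distance and the hybrid bound.
  have hx : ∀ x ∈ S, (1 : ℝ) ≤ 72 * t * ∑ s ∈ Finset.range t, (M.run A y s).prob (P x) := by
    intro x hx
    obtain ⟨hxn, t', -, hhalt', hacc, -⟩ := Finset.mem_filter.1 hx
    have hmem : y ∈ rangeLanguage (forceOnes x A) :=
      ones_mem_rangeLanguage_iff.2 ⟨x, mem_strings.1 hxn, allOnes_forceOnes x A⟩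
    obtain ⟨m, hm, hdist⟩ := exists_le_normSq_run_sub hM hhalt (hrej hn) hhalt' (hacc hmem)
    have hhyb := normSq_run_sub_le hM (A := A) (B := forceOnes x A) (W := (codes x : Set _))
      (fun w hw => (forceOnes_of_notMem A (by simpa using hw)).symm) y m
    have hmono : ∑ s ∈ Finset.range m, (M.run A y s).prob (P x) ≤
        ∑ s ∈ Finset.range t, (M.run A y s).prob (P x) :=
      Finset.sum_le_sum_of_subset_of_nonneg (Finset.range_mono hm)
        fun _ _ _ => Superposition.prob_nonneg _ _
    have h0 : 0 ≤ ∑ s ∈ Finset.range m, (M.run A y s).prob (P x) :=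
      Finset.sum_nonneg fun _ _ => Superposition.prob_nonneg _ _
    have hmt : (m : ℝ) ≤ t := by exact_mod_cast hm
    have := mul_le_mul hmt hmono h0 (by positivity)
    linarith
  -- At each time a configuration queries at most one string, which lies in at most one `codes x`;
  -- the events `P x` are therefore exclusive and each time contributes at most `1`.
  have hsum : ∑ x ∈ S, ∑ s ∈ Finset.range t, (M.run A y s).prob (P x) ≤ t := by
    rw [Finset.sum_comm]
    calc _ ≤ ∑ s ∈ Finset.range t, (1 : ℝ) := by
          refine Finset.sum_le_sum fun s _ => ?_
          rw [← normSq_run hM A y s]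
          refine Superposition.sum_prob_le_normSq S P ?_ _
          rintro x - x' - c ⟨w, hw, hcw⟩ ⟨w', hw', hcw'⟩
          rw [hcw, Option.some_inj] at hcw'
          subst hcw'
          exact eq_of_mem_codes hw hw'
      _ = t := by simp
  calc (S.card : ℝ) = ∑ x ∈ S, (1 : ℝ) := by simp
    _ ≤ ∑ x ∈ S, 72 * t * ∑ s ∈ Finset.range t, (M.run A y s).prob (P x) :=
        Finset.sum_le_sum hx
    _ = 72 * t * ∑ x ∈ S, ∑ s ∈ Finset.range t, (M.run A y s).prob (P x) := by
        rw [Finset.mul_sum]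
    _ ≤ 72 * t * t := by gcongr
    _ ≤ 72 * T ^ 2 := by
        have : (t : ℝ) ^ 2 ≤ T ^ 2 := by gcongr
        nlinarith

end OracleQTM

/-! ### Events that depend on finitely many answers of a random oracle -/

instance : IsProbabilityMeasure randomOracle := by
  unfold randomOracle
  infer_instance

/-- Such an event is a cylinder over a finite discrete space, which gives both measurability and
independence. -/
theorem DependsOn.preimage_image_restrict {E : Set Oracle} {F : Finset (List Bool)}
    (hE : DependsOn (· ∈ E) (F : Set (List Bool))) :
    (fun (A : Oracle) (w : F) => A w) ⁻¹' ((fun (A : Oracle) (w : F) => A w) '' E) = E := by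
  refine Set.Subset.antisymm ?_ (Set.subset_preimage_image _ _)
  rintro A ⟨B, hB, hBA⟩
  have h : (B ∈ E) = (A ∈ E) := hE fun w hw => congrFun hBA ⟨w, hw⟩
  exact h ▸ hB

theorem measurableSet_of_dependsOn {E : Set Oracle} {F : Finset (List Bool)}
    (hE : DependsOn (· ∈ E) (F : Set (List Bool))) : MeasurableSet E := by
  rw [← DependsOn.preimage_image_restrict hE]
  exact (measurable_pi_lambda _ fun w => measurable_pi_apply _) (Set.toFinite _).measurableSet

/-- Events that depend on disjoint finite sets of answers are independent. -/
theorem measureReal_inter_of_dependsOn {E E' : Set Oracle} {F F' : Finset (List Bool)}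
    (hE : DependsOn (· ∈ E) (F : Set (List Bool))) (hE' : DependsOn (· ∈ E') (F' : Set (List Bool)))
    (hF : Disjoint F F') :
    randomOracle.real (E ∩ E') = randomOracle.real E * randomOracle.real E' := by
  have hind : ProbabilityTheory.iIndepFun (fun (w : List Bool) (A : Oracle) => A w)
      randomOracle :=
    ProbabilityTheory.iIndepFun_infinitePi (X := fun _ b => b) fun _ => measurable_id
  have h := (hind.indepFun_finset F F' hF fun w => measurable_pi_apply w).measure_inter_preimage_eq_mul
    ((fun (A : Oracle) (w : F) => A w) '' E) ((fun (A : Oracle) (w : F') => A w) '' E')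
    (Set.toFinite _).measurableSet (Set.toFinite _).measurableSet
  rw [DependsOn.preimage_image_restrict hE, DependsOn.preimage_image_restrict hE'] at h
  rw [measureReal_def, h, ENNReal.toReal_mul]
  rfl

theorem measureReal_allOnes (x : List Bool) :
    randomOracle.real {A | AllOnes x A} = (1 / 2) ^ x.length := by
  have h : {A : Oracle | AllOnes x A} = Set.pi (codes x : Set (List Bool)) fun _ => {true} := by
    ext A
    simp [AllOnes, Set.mem_pi]
  rw [measureReal_def, h, randomOracle, Measure.infinitePi_pi _ fun _ _ => measurableSet_singleton _,
    Finset.prod_const, card_codes, ENNReal.toReal_pow]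
  congr 1
  rw [PMF.toMeasure_apply_singleton _ _ (measurableSet_singleton _),
    PMF.uniformOfFintype_apply]
  simp

theorem dependsOn_mem_iff {E : Set Oracle} {F : Set (List Bool)} :
    DependsOn (· ∈ E) F ↔ ∀ A B : Oracle, (∀ w ∈ F, A w = B w) → (A ∈ E ↔ B ∈ E) :=
  ⟨fun h _ _ hAB => iff_of_eq (h hAB), fun h _ _ hAB => propext (h _ _ hAB)⟩

theorem DependsOn.inter {E E' : Set Oracle} {F F' : Set (List Bool)}
    (hE : DependsOn (· ∈ E) F) (hE' : DependsOn (· ∈ E') F') :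
    DependsOn (· ∈ E ∩ E') (F ∪ F') := by
  rw [dependsOn_mem_iff] at *
  exact fun A B h => and_congr (hE A B fun w hw => h w (Or.inl hw))
    (hE' A B fun w hw => h w (Or.inr hw))

theorem DependsOn.compl {E : Set Oracle} {F : Set (List Bool)} (hE : DependsOn (· ∈ E) F) :
    DependsOn (· ∈ Eᶜ) F := by
  rw [dependsOn_mem_iff] at *
  exact fun A B h => not_congr (hE A B h)

theorem dependsOn_allOnes (x : List Bool) :
    DependsOn (· ∈ {A | AllOnes x A}) (codes x : Set (List Bool)) := by
  rw [dependsOn_mem_iff]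
  exact fun A B h => forall₂_congr fun w hw => by rw [h w hw]

/-- No value at an argument in `X` consists of ones. -/
def avoiding (X : Finset (List Bool)) : Set Oracle := {A | ∀ x ∈ X, ¬ AllOnes x A}

theorem dependsOn_avoiding (X : Finset (List Bool)) :
    DependsOn (· ∈ avoiding X) (X.biUnion codes : Set (List Bool)) := by
  rw [dependsOn_mem_iff]
  exact fun A B h => forall₂_congr fun x hx => not_congr (forall₂_congr fun w hw => by
    rw [h w (Finset.mem_coe.2 (Finset.mem_biUnion.2 ⟨x, hx, hw⟩))])

/-- The blocks `codes x` are disjoint, so each argument contributes an independent factor. -/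
theorem measureReal_avoiding {n : ℕ} {X : Finset (List Bool)} (hX : ∀ x ∈ X, x.length = n) :
    randomOracle.real (avoiding X) = (1 - (1 / 2) ^ n) ^ X.card := by
  induction X using Finset.induction_on with
  | empty => simp [avoiding]
  | insert x X hx ih =>
    have h : avoiding (insert x X) = avoiding X ∩ {A | AllOnes x A}ᶜ := by
      ext A
      simp [avoiding, and_comm]
    have hdisj : Disjoint (X.biUnion codes) (codes x) := by
      rw [Finset.disjoint_biUnion_left]
      exact fun x' hx' => disjoint_codes fun h => hx (h ▸ hx')
    rw [h, measureReal_inter_of_dependsOn (dependsOn_avoiding X)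
      (DependsOn.compl (dependsOn_allOnes x)) hdisj,
      ih fun x' hx' => hX x' (Finset.mem_insert_of_mem hx'),
      probReal_compl_eq_one_sub (measurableSet_of_dependsOn (dependsOn_allOnes x)),
      measureReal_allOnes, hX x (Finset.mem_insert_self _ _), Finset.card_insert_of_notMem hx,
      pow_succ]

/-- Bernoulli's inequality with exponent `2^(n-1)` gives `1/2`, and squaring gives `1/4`. For `n =
0` the empty string trivially has the value `1^0`, and the probability is `0`. -/
theorem quarter_le_measureReal_avoiding {n : ℕ} (hn : 1 ≤ n) :
    1 / 4 ≤ randomOracle.real (avoiding (strings n)) := by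
  rw [measureReal_avoiding fun x => mem_strings.1, card_strings]
  obtain ⟨m, rfl⟩ : ∃ m, n = m + 1 := ⟨n - 1, by omega⟩
  have h1 : (1 / 2 : ℝ) ≤ (1 + -(1 / 2) ^ (m + 1)) ^ 2 ^ m := by
    refine le_trans (le_of_eq ?_) (one_add_mul_le_pow (a := -(1 / 2 : ℝ) ^ (m + 1)) ?_ (2 ^ m))
    · push_cast
      rw [pow_succ, mul_neg, ← mul_assoc, ← mul_pow]
      norm_num
    · have : (1 / 2 : ℝ) ^ (m + 1) ≤ 1 := pow_le_one₀ (by norm_num) (by norm_num)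
      linarith
  rw [pow_succ 2 m, pow_mul, sub_eq_add_neg]
  nlinarith

/-- After forcing, the original answers on `codes x` no longer matter; this makes the preimage
independent of `AllOnes x`. -/
theorem DependsOn.preimage_forceOnes {E : Set Oracle} {F : Finset (List Bool)} (x : List Bool)
    (hE : DependsOn (· ∈ E) (F : Set (List Bool))) :
    DependsOn (· ∈ forceOnes x ⁻¹' E) ((F \ codes x : Finset (List Bool)) : Set (List Bool)) := by
  rw [dependsOn_mem_iff] at *
  refine fun A B h => hE _ _ fun w hw => ?_
  unfold forceOnes
  split_ifs with hx
  · rfl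
  · exact h w (by simpa using ⟨hw, hx⟩)

/-- Conditioning on the value at `x` consisting of ones amounts to changing it to ones. -/
theorem measureReal_inter_allOnes {E : Set Oracle} {F : Finset (List Bool)}
    (hE : DependsOn (· ∈ E) (F : Set (List Bool))) (x : List Bool) :
    randomOracle.real (E ∩ {A | AllOnes x A}) =
      randomOracle.real (forceOnes x ⁻¹' E) * (1 / 2) ^ x.length := by
  have h : E ∩ {A | AllOnes x A} = forceOnes x ⁻¹' E ∩ {A | AllOnes x A} := by
    ext A
    refine and_congr_left fun hA => ?_
    rw [Set.mem_preimage, forceOnes_eq_self hA]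
  rw [h, measureReal_inter_of_dependsOn (DependsOn.preimage_forceOnes x hE) (dependsOn_allOnes x)
    Finset.sdiff_disjoint, measureReal_allOnes]

theorem allOnes_forceOnes_iff {x x' : List Bool} (h : x' ≠ x) (A : Oracle) :
    AllOnes x' (forceOnes x A) ↔ AllOnes x' A :=
  forall₂_congr fun w hw => by
    rw [forceOnes_of_notMem A fun hx => h (eq_of_mem_codes hw hx)]

open scoped Classical in
/-- Let `E` be an event that, if no value at a string of length `n` consists of ones, is destroyed
by at least half of the changes of a value to ones. Then `E` has probability at most `7/8`, even
under a condition `H` on the answers that do not contribute to these values. -/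
theorem measureReal_inter_le {n : ℕ} (hn : 1 ≤ n) {H E : Set Oracle} {G F : Finset (List Bool)}
    (hH : DependsOn (· ∈ H) (G : Set (List Bool))) (hE : DependsOn (· ∈ E) (F : Set (List Bool)))
    (hG : Disjoint G ((strings n).biUnion codes))
    (hchange : ∀ A ∈ E, A ∈ avoiding (strings n) →
      2 * ((strings n).filter fun x => forceOnes x A ∈ E).card ≤ 2 ^ n) :
    randomOracle.real (H ∩ E) ≤ 7 / 8 * randomOracle.real H := by
  set X := strings n with hX
  set C := avoiding X with hC
  have hHm := measurableSet_of_dependsOn hH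
  have hEm := measurableSet_of_dependsOn hE
  have hCm : MeasurableSet C := measurableSet_of_dependsOn (dependsOn_avoiding X)
  have hforce : ∀ x, MeasurableSet (forceOnes x ⁻¹' Eᶜ) := fun x =>
    measurableSet_of_dependsOn (DependsOn.preimage_forceOnes x (DependsOn.compl hE))
  -- `K x` collects the oracles without an all-ones value for which forcing ones at `x` destroys
  -- `E`. The matching `D x` below collects the oracles outside `E` for which `x` is the only
  -- argument of length `n` with an all-ones value.
  set K : List Bool → Set Oracle := fun x => H ∩ C ∩ forceOnes x ⁻¹' Eᶜ with hK
  have hKm : ∀ x, MeasurableSet (K x) := fun x => (hHm.inter hCm).inter (hforce x)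
  set Z : List Bool → Set Oracle := fun x => H ∩ (avoiding (X.erase x) ∩ Eᶜ) with hZ
  have hZdep : ∀ x, DependsOn (· ∈ Z x)
      ((G ∪ ((X.erase x).biUnion codes ∪ F) : Finset (List Bool)) : Set (List Bool)) := by
    intro x
    rw [Finset.coe_union, Finset.coe_union]
    exact DependsOn.inter hH (DependsOn.inter (dependsOn_avoiding _) (DependsOn.compl hE))
  set D : List Bool → Set Oracle := fun x => Z x ∩ {A | AllOnes x A} with hD
  have hDm : ∀ x, MeasurableSet (D x) := fun x =>
    (measurableSet_of_dependsOn (hZdep x)).inter (measurableSet_of_dependsOn (dependsOn_allOnes x))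
  have hKD : ∀ x ∈ X, randomOracle.real (K x) * (1 / 2) ^ n ≤ randomOracle.real (D x) := by
    intro x hx
    rw [hD, measureReal_inter_allOnes (hZdep x), mem_strings.1 hx]
    refine mul_le_mul_of_nonneg_right (measureReal_mono ?_) (by positivity)
    rintro A ⟨⟨hAH, hAC⟩, hAE⟩
    refine ⟨(dependsOn_mem_iff.1 hH A _ fun w hw => ?_).1 hAH, fun x' hx' => ?_, hAE⟩
    · refine (forceOnes_of_notMem A fun hwx => ?_).symm
      exact Finset.disjoint_left.1 hG hw (Finset.mem_biUnion.2 ⟨x, hx, hwx⟩)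
    · rw [allOnes_forceOnes_iff (Finset.ne_of_mem_erase hx')]
      exact hAC x' (Finset.mem_of_mem_erase hx')
  -- Double counting: by `hchange`, each oracle in `H ∩ C ∩ E` lies in at least `2^n / 2` of the
  -- sets `K x`. Integrating the sum of the indicators gives the bound.
  have hsumK : (2 : ℝ) ^ n / 2 * randomOracle.real (H ∩ C ∩ E) ≤
      ∑ x ∈ X, randomOracle.real (K x) := by
    have hint : ∀ x ∈ X, Integrable ((K x).indicator fun _ => (1 : ℝ)) randomOracle := fun x _ =>
      (integrable_const _).indicator (hKm x)
    have h1 : ∀ x ∈ X, randomOracle.real (K x) =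
        ∫ A, (K x).indicator (fun _ => (1 : ℝ)) A ∂randomOracle := fun x _ => by
      rw [integral_indicator_const _ (hKm x), smul_eq_mul, mul_one]
    rw [Finset.sum_congr rfl h1, ← integral_finsetSum X hint, mul_comm, ← smul_eq_mul,
      ← integral_indicator_const _ ((hHm.inter hCm).inter hEm)]
    refine integral_mono ((integrable_const _).indicator ((hHm.inter hCm).inter hEm))
      (integrable_finsetSum X hint) fun A => ?_
    by_cases hA : A ∈ H ∩ C ∩ E
    · have h2 : ∑ x ∈ X, (K x).indicator (fun _ => (1 : ℝ)) A =
          ((X.filter fun x => ¬ forceOnes x A ∈ E).card : ℝ) := by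
        rw [Finset.card_filter, Nat.cast_sum]
        refine Finset.sum_congr rfl fun x _ => ?_
        by_cases hx : forceOnes x A ∈ E
        · rw [Set.indicator_of_notMem fun h : A ∈ K x => h.2 hx]
          simp [hx]
        · rw [Set.indicator_of_mem (show A ∈ K x from ⟨hA.1, hx⟩)]
          simp [hx]
      dsimp only
      rw [Set.indicator_of_mem hA, h2]
      have h3 := Finset.card_filter_add_card_filter_not (s := X) fun x => forceOnes x A ∈ E
      rw [hX, card_strings, ← hX] at h3
      have h4 := hchange A hA.2 hA.1.2
      have h5 : 2 ^ n ≤ 2 * (X.filter fun x => ¬ forceOnes x A ∈ E).card := by omega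
      have h6 : (2 : ℝ) ^ n ≤ 2 * ((X.filter fun x => ¬ forceOnes x A ∈ E).card : ℝ) := by
        exact_mod_cast h5
      linarith
    · dsimp only
      rw [Set.indicator_of_notMem hA]
      exact Finset.sum_nonneg fun x _ => Set.indicator_nonneg (fun _ _ => zero_le_one) A
  have hsumD : randomOracle.real (⋃ x ∈ X, D x) = ∑ x ∈ X, randomOracle.real (D x) := by
    refine measureReal_biUnion_finset (fun x hx x' hx' hne => ?_) fun x _ => hDm x
    refine Set.disjoint_left.2 fun A hA hA' => ?_
    exact hA.1.2.1 x' (Finset.mem_erase.2 ⟨hne.symm, hx'⟩) hA'.2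
  have hDC : Disjoint (H ∩ C ∩ Eᶜ) (⋃ x ∈ X, D x) := by
    refine Set.disjoint_left.2 fun A hA hA' => ?_
    obtain ⟨x, hx, hAx⟩ := Set.mem_iUnion₂.1 hA'
    exact hA.1.2 x hx hAx.2
  -- The sets `D x` are disjoint from each other, by uniqueness of the all-ones argument, and from
  -- `C`. They and `H ∩ C ∩ Eᶜ` are thus separate portions of `H \ E`, of total probability at least
  -- `1/2 * P(H ∩ C) ≥ 1/8 * P(H)`.
  have hwrong : randomOracle.real (H ∩ C ∩ Eᶜ) + ∑ x ∈ X, randomOracle.real (D x) ≤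
      randomOracle.real (H \ E) := by
    have hDUm : MeasurableSet (⋃ x ∈ X, D x) := X.measurableSet_biUnion fun x _ => hDm x
    rw [← hsumD, ← measureReal_union hDC hDUm (measure_ne_top _ _) (measure_ne_top _ _)]
    refine measureReal_mono (Set.union_subset ?_ (Set.iUnion₂_subset fun x _ => ?_))
    · exact fun A hA => ⟨hA.1.1, hA.2⟩
    · exact fun A hA => ⟨hA.1.1, hA.1.2.2⟩
  have hKDsum : (∑ x ∈ X, randomOracle.real (K x)) * (1 / 2) ^ n ≤
      ∑ x ∈ X, randomOracle.real (D x) := by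
    rw [Finset.sum_mul]
    exact Finset.sum_le_sum hKD
  have hhalf : 1 / 2 * randomOracle.real (H ∩ C ∩ E) ≤ ∑ x ∈ X, randomOracle.real (D x) := by
    refine le_trans ?_ hKDsum
    refine le_trans (le_of_eq ?_) (mul_le_mul_of_nonneg_right hsumK (by positivity))
    rw [one_div_pow]
    field_simp
  have hHC : randomOracle.real (H ∩ C) = randomOracle.real H * randomOracle.real C :=
    measureReal_inter_of_dependsOn hH (dependsOn_avoiding X) hG
  have hquarter := quarter_le_measureReal_avoiding hn
  have hsplit : randomOracle.real (H ∩ C ∩ E) + randomOracle.real (H ∩ C ∩ Eᶜ) =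
      randomOracle.real (H ∩ C) := by
    rw [← Set.sdiff_eq]
    exact measureReal_inter_add_sdiff hEm
  have hsplit' : randomOracle.real (H ∩ E) + randomOracle.real (H \ E) = randomOracle.real H :=
    measureReal_inter_add_sdiff hEm
  have hnonneg : 0 ≤ randomOracle.real (H ∩ C ∩ Eᶜ) := measureReal_nonneg
  have := mul_le_mul_of_nonneg_left hquarter (measureReal_nonneg (μ := randomOracle) (s := H))
  rw [← hX, ← hC] at this
  linarith

open scoped Classical in
/-- A fixed machine is correct on all inputs `1^n` with probability zero. -/
theorem measure_forall_correctOn_eq_zero {M : OracleQTM} (hM : M.WellFormed) {T : ℕ → ℝ}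
    (hT : T =o[atTop] fun n : ℕ => (2 : ℝ) ^ ((n : ℝ) / 2)) :
    randomOracle {A | ∀ n, M.CorrectOn (T n) (List.replicate n true) A} = 0 := by
  -- `144 = 2 * 72` makes the noticed changes at most half of all; the little-o constant `1/12` is
  -- its inverse square root.
  obtain ⟨N, hN⟩ : ∃ N, ∀ n ≥ N, T n ^ 2 ≤ 2 ^ n / 144 := by
    obtain ⟨N, hN⟩ := eventually_atTop.1 (hT.bound (c := 1 / 12) (by norm_num))
    refine ⟨N, fun n hn => ?_⟩
    have h1 := hN n hn
    rw [Real.norm_eq_abs, Real.norm_eq_abs, abs_of_pos (Real.rpow_pos_of_pos two_pos _)] at h1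
    have h2 : ((2 : ℝ) ^ ((n : ℝ) / 2)) ^ 2 = 2 ^ n := by
      rw [← Real.rpow_natCast, ← Real.rpow_mul (by norm_num)]
      norm_num
    rw [← sq_abs, ← h2]
    have h3 := pow_le_pow_left₀ (abs_nonneg (T n)) h1 2
    linarith
  have key : ∀ k : ℕ, ∃ (H : Set Oracle) (G : Finset (List Bool)),
      DependsOn (· ∈ H) (G : Set (List Bool)) ∧
      {A | ∀ n, M.CorrectOn (T n) (List.replicate n true) A} ⊆ H ∧
      randomOracle.real H ≤ (7 / 8) ^ k := by
    intro k
    induction k with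
    | zero =>
      exact ⟨Set.univ, ∅, dependsOn_mem_iff.2 fun _ _ _ => Iff.rfl, Set.subset_univ _, by simp⟩
    | succ k ih =>
      obtain ⟨H, G, hH, hsub, hle⟩ := ih
      -- Every code of a string of length `n` is longer than `n`, so this choice makes the new block
      -- of answers disjoint from those that `H` depends on.
      obtain ⟨n, hnN, hn1, hnG⟩ : ∃ n, N ≤ n ∧ 1 ≤ n ∧ ∀ w ∈ G, w.length ≤ n :=
        ⟨max N (max 1 (G.sup List.length)), le_max_left _ _,
          (le_max_left _ _).trans (le_max_right _ _), fun w hw =>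
          (Finset.le_sup (f := List.length) hw).trans ((le_max_right _ _).trans (le_max_right _ _))⟩
      set E : Set Oracle := {A | M.CorrectOn (T n) (List.replicate n true) A}
      set F : Finset (List Bool) := (List.finite_length_le Bool (2 * n + ⌊T n⌋₊)).toFinset with hF
      have hE : DependsOn (· ∈ E) (F : Set (List Bool)) :=
        dependsOn_mem_iff.2 fun A B h => M.correctOn_congr fun w hw => h w (by simpa [hF] using hw)
      have hdisj : Disjoint G ((strings n).biUnion codes) := by
        refine Finset.disjoint_left.2 fun w hw hw' => ?_
        obtain ⟨x, hx, hwx⟩ := Finset.mem_biUnion.1 hw'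
        have h1 := length_lt_of_mem_codes hwx
        rw [mem_strings.1 hx] at h1
        exact absurd (hnG w hw) (by omega)
      refine ⟨H ∩ E, G ∪ F, ?_, fun A hA => ⟨hsub hA, hA n⟩, ?_⟩
      · rw [Finset.coe_union]
        exact DependsOn.inter hH hE
      · have h := measureReal_inter_le hn1 hH hE hdisj fun A hA hAC => by
          have hnot : List.replicate n true ∉ rangeLanguage A := by
            rw [ones_mem_rangeLanguage_iff]
            rintro ⟨x, hx, hAx⟩
            exact hAC x (mem_strings.2 hx) hAx
          have h1 := OracleQTM.card_correctOn_forceOnes_le hM hA hnot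
          have h2 := hN n hnN
          have h3 : (2 : ℝ) * (((strings n).filter fun x =>
            M.CorrectOn (T n) (List.replicate n true) (forceOnes x A)).card : ℝ) ≤ 2 ^ n := by
            linarith
          exact_mod_cast h3
        rw [pow_succ]
        linarith
  have hreal : randomOracle.real {A | ∀ n, M.CorrectOn (T n) (List.replicate n true) A} ≤ 0 := by
    refine ge_of_tendsto' (tendsto_pow_atTop_nhds_zero_of_lt_one (r := (7 / 8 : ℝ)) (by norm_num)
      (by norm_num)) fun k => ?_
    obtain ⟨H, -, -, hsub, hle⟩ := key k
    exact (measureReal_mono hsub).trans hle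
  exact (measureReal_eq_zero_iff).1 (le_antisymm hreal measureReal_nonneg)

/-! ### There are only countably many machines -/

instance : Countable OracleNTM := by
  refine Function.Surjective.countable
    (α := Σ k s : ℕ, (Fin s × Fin s × Fin s × Fin s) ×
      (Fin s → Sym k → Set (Sym k × Fin s × Move)))
    (f := fun u => ⟨u.1, u.2.1, u.2.2.1.1, u.2.2.1.2.1, u.2.2.1.2.2.1, u.2.2.1.2.2.2, u.2.2.2⟩)
    fun M => ⟨⟨M.k, M.s, (M.start, M.halt, M.pre, M.post), M.δ⟩, rfl⟩

theorem OracleNTM.Deterministic.eq_of_reachesIn {M : OracleNTM} (hM : M.Deterministic)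
    {A : Oracle} {t t' : ℕ} {c d d' : Config M.k M.s} (h : M.ReachesIn A t c d)
    (h' : M.ReachesIn A t' c d') (hd : d.state = M.halt) (hd' : d'.state = M.halt) : d = d' := by
  induction t generalizing c t' with
  | zero =>
    obtain rfl : c = d := h
    cases t' with
    | zero => exact h'
    | succ t' =>
      obtain ⟨e, he, -⟩ := h'
      exact absurd hd he.1
  | succ t ih =>
    obtain ⟨e, he, hed⟩ := h
    cases t' with
    | zero =>
      obtain rfl : c = d' := h'
      exact absurd hd' he.1
    | succ t' =>
      obtain ⟨e', he', hed'⟩ := h'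
      have hee : e = e' := by
        rcases he.2 with ⟨hp, rfl⟩ | ⟨hp, r, hr, rfl⟩
        · rcases he'.2 with ⟨-, rfl⟩ | ⟨hp', -⟩
          · rfl
          · exact absurd hp hp'
        · rcases he'.2 with ⟨hp', -⟩ | ⟨-, r', hr', rfl⟩
          · exact absurd hp' hp
          · rw [hM _ _ hr hr']
      subst hee
      exact ih hed hed'

/-- A deterministic machine reaches only one halting configuration per input. It therefore outputs
one approximation for each `n`, and two reals approximated by the same machine coincide. -/
theorem countable_polyTimeReal : {r | PolyTimeReal r}.Countable := by
  have h : {r | PolyTimeReal r} ⊆ ⋃ M : OracleNTM, {r | M.Deterministic ∧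
      ∀ n : ℕ, ∃ (t : ℕ) (c : Config M.k M.s) (sgn : Bool) (w : List Bool),
        M.ReachesIn (fun _ => false) t (Config.init M.k M.start (List.replicate n true)) c ∧
        c.state = M.halt ∧ c.track (Fin.last (M.k + 2)) = block 0 (sgn :: w) ∧
        |r - (signedValue sgn w : ℝ) / 2 ^ n| ≤ 1 / 2 ^ n} := by
    rintro r ⟨M, p, hM, hr⟩
    refine Set.mem_iUnion.2 ⟨M, hM, fun n => ?_⟩
    obtain ⟨t, -, hr⟩ := hr n
    exact ⟨t, hr⟩
  refine Set.Countable.mono h (Set.countable_iUnion fun M => Set.Subsingleton.countable ?_)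
  rintro r ⟨hM, hr⟩ r' ⟨-, hr'⟩
  have hle : ∀ n : ℕ, |r - r'| ≤ 2 * (1 / 2) ^ n := by
    intro n
    obtain ⟨t, c, sgn, w, h1, h2, h3, h4⟩ := hr n
    obtain ⟨t', c', sgn', w', h1', h2', h3', h4'⟩ := hr' n
    obtain rfl := hM.eq_of_reachesIn h1 h1' h2 h2'
    obtain ⟨-, hw⟩ := block_injective (List.cons_ne_nil _ _) (h3.symm.trans h3')
    obtain ⟨rfl, rfl⟩ := List.cons.inj hw
    rw [one_div_pow]
    rw [abs_le] at *
    constructor <;> linarith [h4.1, h4.2, h4'.1, h4'.2]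
  have hlim : Tendsto (fun n : ℕ => 2 * (1 / 2 : ℝ) ^ n) atTop (nhds (2 * 0)) :=
    (tendsto_pow_atTop_nhds_zero_of_lt_one (by norm_num) (by norm_num)).const_mul 2
  rw [mul_zero] at hlim
  have := ge_of_tendsto' hlim hle
  exact sub_eq_zero.1 (abs_nonpos_iff.1 this)

instance : Countable PolyTimeComplex := by
  have h : PolyTimeComplex =
      (fun z : ℂ => (z.re, z.im)) ⁻¹' ({r | PolyTimeReal r} ×ˢ {r | PolyTimeReal r}) := rfl
  rw [Set.countable_coe_iff, h]
  refine (countable_polyTimeReal.prod countable_polyTimeReal).preimage fun z z' hz => ?_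
  exact Complex.ext (congrArg Prod.fst hz) (congrArg Prod.snd hz)

instance : Countable OracleQTM := by
  have h (k s : ℕ) : Countable (Fin s → Sym k → Sym k × Fin s × Move → PolyTimeComplex) :=
    inferInstance
  refine Function.Injective.countable
    (β := Σ k s : ℕ, (Fin s × Fin s × Fin s × Fin s) ×
      (Fin s → Sym k → Sym k × Fin s × Move → PolyTimeComplex))
    (f := fun M => ⟨M.k, M.s, (M.start, M.final, M.pre, M.post),
      fun q σ r => ⟨M.δ q σ r, M.δ_mem q σ r⟩⟩) ?_
  rintro ⟨k, s, a, b, c, d, h1, h2, h3, δ, hδ⟩ ⟨k', s', a', b', c', d', h1', h2', h3', δ', hδ'⟩ h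
  rw [Sigma.mk.injEq] at h
  obtain ⟨rfl, h⟩ := h
  rw [heq_eq_eq, Sigma.mk.injEq] at h
  obtain ⟨rfl, h⟩ := h
  rw [heq_eq_eq, Prod.mk.injEq, Prod.mk.injEq, Prod.mk.injEq, Prod.mk.injEq] at h
  obtain ⟨⟨rfl, rfl, rfl, rfl⟩, h⟩ := h
  obtain rfl : δ = δ' := by
    funext q σ r
    exact congrArg Subtype.val (congrFun (congrFun (congrFun h q) σ) r)
  rfl

/-- A countable union of null sets, one for each machine; the inputs `1^n` suffice. -/
theorem ae_rangeLanguage_notMem_BQTime {T : ℕ → ℝ}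
    (hT : T =o[atTop] fun n : ℕ => (2 : ℝ) ^ ((n : ℝ) / 2)) :
    ∀ᵐ A ∂randomOracle, rangeLanguage A ∉ BQTime A T := by
  have h : ∀ᵐ A ∂randomOracle, ∀ M : OracleQTM, M.WellFormed →
      ¬ ∀ n, M.CorrectOn (T n) (List.replicate n true) A := by
    rw [ae_all_iff]
    intro M
    by_cases hM : M.WellFormed
    · have h0 := measure_forall_correctOn_eq_zero hM hT
      filter_upwards [measure_eq_zero_iff_ae_notMem.1 h0] with A hA _ using hA
    · exact Eventually.of_forall fun A hM' => absurd hM' hM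
  filter_upwards [h] with A hA
  rintro ⟨M, hM, -, hdec⟩
  refine hA M hM fun n => ?_
  obtain ⟨t, ht, hhalt, -, -, hacc, hrej⟩ := hdec (List.replicate n true)
  rw [List.length_replicate] at ht
  exact ⟨t, ht, hhalt, hacc, hrej⟩

/-! ### Editing blocks -/

theorem exists_block_eq_bit {p i : ℤ} {w : List Bool} (h1 : p ≤ i) (h2 : i < p + w.length) :
    ∃ b, block p w i = Cell.bit b := by
  obtain ⟨j, rfl⟩ : ∃ j : ℕ, i = p + j := ⟨(i - p).toNat, by omega⟩
  exact ⟨_, block_add_of_lt p (by omega)⟩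

theorem update_block_last (p : ℤ) (w : List Bool) (b b' : Bool) :
    Function.update (block p (w ++ [b])) (p + w.length) (Cell.bit b') = block p (w ++ [b']) := by
  funext i
  rcases lt_or_ge i p with h | h
  · rw [Function.update_of_ne (by omega), block_of_lt _ h, block_of_lt _ h]
  · obtain ⟨j, rfl⟩ : ∃ j : ℕ, i = p + j := ⟨(i - p).toNat, by omega⟩
    rcases eq_or_ne j w.length with rfl | hj
    · rw [Function.update_self, block_add_of_lt p (by simp)]
      simp
    · rw [Function.update_of_ne (by omega), block_add, block_add]
      rcases lt_or_gt_of_ne hj with hj | hj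
      · rw [List.getElem?_append_left hj, List.getElem?_append_left hj]
      · rw [List.getElem?_eq_none (by simp; omega), List.getElem?_eq_none (by simp; omega)]

theorem update_block_last_blank (p : ℤ) (w : List Bool) (b : Bool) :
    Function.update (block p (w ++ [b])) (p + w.length) Cell.blank = block p w := by
  funext i
  rcases lt_or_ge i p with h | h
  · rw [Function.update_of_ne (by omega), block_of_lt _ h, block_of_lt _ h]
  · obtain ⟨j, rfl⟩ : ∃ j : ℕ, i = p + j := ⟨(i - p).toNat, by omega⟩
    rcases eq_or_ne j w.length with rfl | hj
    · rw [Function.update_self, block_of_ge le_rfl]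
    · rw [Function.update_of_ne (by omega), block_add, block_add]
      rcases lt_or_gt_of_ne hj with hj | hj
      · rw [List.getElem?_append_left hj]
      · rw [List.getElem?_eq_none (by simp; omega), List.getElem?_eq_none (by omega)]

theorem update_block_append (p : ℤ) (w : List Bool) (b : Bool) :
    Function.update (block p w) (p + w.length) (Cell.bit b) = block p (w ++ [b]) := by
  rw [← update_block_last_blank p w b, Function.update_idem, update_block_last]

theorem update_block_first_blank (p : ℤ) (w : List Bool) (b : Bool) :
    Function.update (block p (b :: w)) p Cell.blank = block (p + 1) w := by
  funext i
  rcases lt_trichotomy i p with h | rfl | h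
  · rw [Function.update_of_ne (by omega), block_of_lt _ h, block_of_lt _ (by omega)]
  · rw [Function.update_self, block_of_lt _ (by omega)]
  · obtain ⟨j, rfl⟩ : ∃ j : ℕ, i = p + 1 + j := ⟨(i - p - 1).toNat, by omega⟩
    have h1 := block_add p (b :: w) (j + 1)
    rw [Function.update_of_ne (by omega), block_add, List.getElem?_cons_succ.symm, ← h1]
    push_cast
    congr 1
    ring

theorem update_block_cons (p : ℤ) (w : List Bool) (b : Bool) :
    Function.update (block (p + 1) w) p (Cell.bit b) = block p (b :: w) := by
  have h := block_add_of_lt p (w := b :: w) (j := 0) (by simp)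
  rw [← update_block_first_blank p w b, Function.update_idem]
  conv_lhs => rw [show Cell.bit b = block p (b :: w) p by simpa using h.symm]
  exact Function.update_eq_self _ _

theorem update_eq_self_of_eq {f : ℤ → Cell} {i : ℤ} {a : Cell} (h : f i = a) :
    Function.update f i a = f := by
  rw [← h, Function.update_eq_self]

theorem Config.track_act {k s : ℕ} (c : Config k s) (σ : Sym k) (q : Fin s) (d : Move)
    (j : Fin (k + 3)) : (c.act σ q d).track j = Function.update (c.track j) c.head (σ j) := by
  classical
  funext i
  unfold track act
  dsimp only
  rw [Finsupp.coe_update, Function.update_apply, Function.update_apply]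
  split_ifs <;> rfl

/-- The block chosen inside `query` must be the given one, by `block_injective`. -/
theorem Config.tape_query {k s : ℕ} {A : Oracle} {post : Fin s} {c : Config k s} {p : ℤ}
    {x : List Bool} {b : Bool} (h : c.track 1 = block p (x ++ [b])) :
    (c.query A post).tape = c.tape.update (p + x.length)
      (Function.update (c.tape (p + x.length)) 1 (Cell.bit (xor b (A x)))) := by
  have hex : ∃ u : ℤ × List Bool × Bool, c.track 1 = block u.1 (u.2.1 ++ [u.2.2]) :=
    ⟨(p, x, b), h⟩
  obtain ⟨h1, h2⟩ := block_injective (by simp) (h.symm.trans hex.choose_spec)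
  obtain ⟨h3, h4⟩ := List.append_inj' h2 rfl
  have h5 : b = hex.choose.2.2 := by simpa using h4
  unfold query
  simp only [dif_pos hex]
  rw [← h1, ← h3, ← h5]

theorem Config.track_one_query {k s : ℕ} {A : Oracle} {post : Fin s} {c : Config k s} {p : ℤ}
    {x : List Bool} {b : Bool} (h : c.track 1 = block p (x ++ [b])) :
    (c.query A post).track 1 = block p (x ++ [xor b (A x)]) := by
  classical
  rw [← update_block_last p x b, ← h]
  funext i
  unfold track
  rw [tape_query h, Finsupp.coe_update, Function.update_apply, Function.update_apply]
  split_ifs with hi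
  · rw [Function.update_self]
  · rfl

theorem Config.track_query_of_ne {k s : ℕ} {A : Oracle} {post : Fin s} {c : Config k s}
    {j : Fin (k + 3)} (hj : j ≠ 1) {p : ℤ}
    {x : List Bool} {b : Bool} (h : c.track 1 = block p (x ++ [b])) :
    (c.query A post).track j = c.track j := by
  classical
  funext i
  unfold track
  rw [tape_query h, Finsupp.coe_update, Function.update_apply]
  split_ifs with hi
  · rw [Function.update_of_ne hj, hi]
  · rfl

theorem Config.track_zero_init {k s : ℕ} (start : Fin s) (x : List Bool) :
    (init k start x).track 0 = block 0 x := by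
  funext i
  exact Function.update_self (0 : Fin (k + 3)) (block 0 x i) (0 : Sym k)

theorem Config.track_init_of_ne {k s : ℕ} (start : Fin s) (x : List Bool) {j : Fin (k + 3)}
    (hj : j ≠ 0) : (init k start x).track j = block 0 [] := by
  funext i
  rw [block_eq_blank_iff.2 (by simp; omega)]
  exact Function.update_of_ne hj (block 0 x i) (0 : Sym k)

/-! ### A nondeterministic machine for the range language -/

namespace RangeMachine

/-- The states of the machine. It guesses a preimage `x` on the query track, below the input `y`. It
then repeatedly goes to the left end of the query string (`ret`) and adds a bit there, so that the
query track holds the code of `x` and `i`, finds the first remaining bit of the input, erases it and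
carries it to the right end of the query string, asks the oracle, and checks that the result is
`0`. -/
inductive Phase : Type
  | guess : Phase
  | ret (b : Bool) : Phase
  | find : Phase
  | carry (b : Bool) : Phase
  | pre : Phase
  | post : Phase
  | check : Phase
  | halt : Phase
  deriving DecidableEq, Fintype

open Phase Cell Move

/-- The transitions: the state and the scanned cells of the input and of the query track, followed by
their new contents, the new state, and the direction of the head. -/
inductive Rule : Phase → Cell → Cell → Cell → Cell → Phase → Move → Prop
  | guess (c b : Bool) (q : Cell) : Rule guess (bit c) q (bit c) (bit b) guess right
  | guessed (q : Cell) : Rule guess blank q blank q (ret false) left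
  | ret (b c : Bool) (a : Cell) : Rule (ret b) a (bit c) a (bit c) (ret b) left
  | extend (b : Bool) (a : Cell) : Rule (ret b) a blank a (bit b) find right
  | skip (c : Bool) : Rule find blank (bit c) blank (bit c) find right
  | hit (c : Bool) (q : Cell) : Rule find (bit c) q blank q (carry c) right
  | done : Rule find blank blank blank blank halt right
  | carry (b c : Bool) (a : Cell) : Rule (carry b) a (bit c) a (bit c) (carry b) right
  | write (b : Bool) (a : Cell) : Rule (carry b) a blank a (bit b) pre right
  | turn (a q : Cell) : Rule post a q a q check left
  | check (a : Cell) : Rule check a (bit false) a blank (ret true) left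

/-- The numbering of the states. -/
noncomputable def code : Phase ≃ Fin (Fintype.card Phase) := Fintype.equivFin Phase

/-- The machine. -/
noncomputable def machine : OracleNTM where
  k := 0
  s := Fintype.card Phase
  start := code guess
  halt := code halt
  pre := code pre
  post := code post
  δ q σ := {r | Rule (code.symm q) (σ 0) (σ 1) (r.1 0) (r.1 1) (code.symm r.2.1) r.2.2}

/-- What matters in a configuration: the state, the head, the input track and the query track. -/
structure View : Type where
  phase : Phase
  head : ℤ
  input : ℤ → Cell
  query : ℤ → Cell

/-- The relevant part of a configuration of the machine. -/
noncomputable def view (c : Config machine.k machine.s) : View :=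
  ⟨code.symm c.state, c.head, c.track 0, c.track 1⟩

/-- The steps of the machine on the relevant parts of the configurations. -/
inductive View.Step (A : Oracle) : View → View → Prop
  | call {h : ℤ} {I Q : ℤ → Cell} {p : ℤ} {x : List Bool} {b : Bool}
      (hQ : Q = block p (x ++ [b])) :
      View.Step A ⟨pre, h, I, Q⟩ ⟨post, h, I, block p (x ++ [xor b (A x)])⟩
  | move {q q' : Phase} {h : ℤ} {I Q : ℤ → Cell} {a b a' b' : Cell} {d : Move}
      (hI : I h = a) (hQ : Q h = b) (hR : Rule q a b a' b' q' d) :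
      View.Step A ⟨q, h, I, Q⟩
        ⟨q', h + d.shift, Function.update I h a', Function.update Q h b'⟩

theorem view_query {A : Oracle} {c : Config machine.k machine.s} {p : ℤ} {x : List Bool} {b : Bool}
    (h : c.track 1 = block p (x ++ [b])) :
    view (c.query A machine.post) = ⟨post, c.head, c.track 0, block p (x ++ [xor b (A x)])⟩ := by
  unfold view
  rw [Config.track_one_query h, Config.track_query_of_ne (by decide) h]
  congr 1
  exact code.symm_apply_apply post

theorem view_act (c : Config machine.k machine.s) (σ : Sym machine.k) (q : Fin machine.s)
    (d : Move) : view (c.act σ q d) = ⟨code.symm q, c.head + d.shift,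
      Function.update (c.track 0) c.head (σ 0), Function.update (c.track 1) c.head (σ 1)⟩ := by
  unfold view
  rw [Config.track_act, Config.track_act]
  rfl

theorem view_init (x : List Bool) :
    view (Config.init machine.k machine.start x) = ⟨guess, 0, block 0 x, block 0 []⟩ := by
  unfold view
  rw [Config.track_zero_init, Config.track_init_of_ne _ _ (by decide)]
  congr 1
  exact code.symm_apply_apply guess

theorem exists_step {A : Oracle} {c : Config machine.k machine.s} {v : View}
    (h : (view c).Step A v) : ∃ c', machine.Step A c c' ∧ view c' = v := by
  generalize hv : view c = u at h
  cases h with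
  | call hQ =>
    simp only [view, View.mk.injEq] at hv
    obtain ⟨h1, rfl, rfl, rfl⟩ := hv
    have h2 : c.state = machine.pre := (code.symm_apply_eq).1 h1
    refine ⟨_, ⟨?_, Or.inl ⟨h2, rfl⟩⟩, view_query hQ⟩
    rw [h2]
    exact fun h => by cases code.injective h
  | @move q q' h I Q a b a' b' d hI hQ hR =>
    simp only [view, View.mk.injEq] at hv
    obtain ⟨h1, rfl, rfl, rfl⟩ := hv
    have hc : c.state = code q := (code.symm_apply_eq).1 h1
    refine ⟨c.act ![a', b', blank] (code q') d, ⟨?_, Or.inr ⟨?_, (![a', b', blank], code q', d), ?_,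
      rfl⟩⟩, ?_⟩
    · rw [hc]
      intro h
      obtain rfl := code.injective h
      cases hR
    · rw [hc]
      intro h
      obtain rfl := code.injective h
      cases hR
    · change Rule (code.symm c.state) (c.track 0 c.head) (c.track 1 c.head) a' b'
        (code.symm (code q')) d
      rwa [h1, hI, hQ, code.symm_apply_apply]
    · refine (view_act c _ (code q') d).trans ?_
      rw [code.symm_apply_apply]
      rfl

/-- The proviso is needed because `View.Step.call` describes only calls with a non-empty query
block. -/
theorem step_view {A : Oracle} {c c' : Config machine.k machine.s} (h : machine.Step A c c')
    (hpre : (view c).phase = pre → ∃ p x b, (view c).query = block p (x ++ [b])) :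
    (view c).Step A (view c') := by
  obtain ⟨-, ⟨hp, rfl⟩ | ⟨-, r, hr, rfl⟩⟩ := h
  · have h1 : code.symm c.state = pre := (code.symm_apply_eq).2 hp
    obtain ⟨p, x, b, hQ⟩ := hpre h1
    rw [view_query hQ]
    have := View.Step.call (A := A) (h := c.head) (I := c.track 0) hQ
    rwa [← h1] at this
  · rw [view_act]
    exact View.Step.move rfl rfl hr

/-! ### The invariant of the computation -/

/-- The first `i` bits of the value at `x` have been found to be those of `y`. -/
def AgreeUpTo (A : Oracle) (y x : List Bool) (i : ℕ) : Prop :=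
  ∀ j < i, y[j]? = some (A (pairCode x j))

theorem lengthPreserving_eq_iff {A : Oracle} {x y : List Bool} (hxy : x.length = y.length) :
    lengthPreserving A x = y ↔ AgreeUpTo A y x y.length := by
  constructor
  · rintro rfl j hj
    rw [length_lengthPreserving] at hj
    simp [lengthPreserving, hj]
  · intro h
    refine List.ext_getElem? fun j => ?_
    rcases lt_or_ge j y.length with hj | hj
    · rw [h j hj]
      simp [lengthPreserving, hxy, hj]
    · rw [List.getElem?_eq_none hj,
        List.getElem?_eq_none (by rwa [length_lengthPreserving, hxy])]

/-- A bound for the number of steps that are needed for the bits from number `i` on. -/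
def roundsLeft (n i : ℕ) : ℕ := (n - i) * (5 * n + 6)

theorem roundsLeft_eq {n i : ℕ} (h : i < n) :
    roundsLeft n i = roundsLeft n (i + 1) + (5 * n + 6) := by
  unfold roundsLeft
  rw [show n - i = n - (i + 1) + 1 by omega, Nat.succ_mul]

/-- The situations that occur on input `y` when the string `x` is guessed, with a bound on the number
of the remaining steps of an accepting computation. -/
inductive Reachable (A : Oracle) (y x : List Bool) : ℕ → View → Prop
  | guess {u : List Bool} (hu : u <+: x) :
      Reachable A y x (roundsLeft y.length 0 + (y.length - u.length) + y.length + 3)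
        ⟨guess, u.length, block 0 y, block 0 u⟩
  -- With `n = |y| = |x|`, the code of `(x, i)` occupies the cells from `-1 - i` to `n - 1`, so its
  -- right end never moves and the target bit always sits in cell `n`. Here the first bit `b` of the
  -- code is still held in the state.
  | ret {i : ℕ} {b : Bool} {w : List Bool} {h : ℤ} (hw : pairCode x i = b :: w)
      (hi : i ≤ y.length) (hA : AgreeUpTo A y x i) (h1 : -1 - i ≤ h) (h2 : h < y.length) :
      Reachable A y x (roundsLeft y.length i + (h + 1 + i).toNat + 2 * i + 2)
        ⟨ret b, h, block i (y.drop i), block (-1 - i + 1) w⟩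
  | find {i : ℕ} {h : ℤ} (hi : i ≤ y.length) (hA : AgreeUpTo A y x i) (h1 : -i ≤ h) (h2 : h ≤ i) :
      Reachable A y x (roundsLeft y.length i + (i - h).toNat + 1)
        ⟨find, h, block i (y.drop i), block (-1 - i) (pairCode x i)⟩
  | carry {i : ℕ} {c : Bool} {h : ℤ} (hi : i < y.length) (hc : y[i]? = some c)
      (hA : AgreeUpTo A y x i) (h1 : i < h) (h2 : h ≤ y.length) :
      Reachable A y x (roundsLeft y.length (i + 1) + 4 * y.length + 6 + (y.length - h).toNat)
        ⟨carry c, h, block (i + 1 : ℕ) (y.drop (i + 1)), block (-1 - i) (pairCode x i)⟩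
  | pre {i : ℕ} {c : Bool} (hi : i < y.length) (hc : y[i]? = some c) (hA : AgreeUpTo A y x i) :
      Reachable A y x (roundsLeft y.length (i + 1) + 4 * y.length + 5)
        ⟨pre, y.length + 1, block (i + 1 : ℕ) (y.drop (i + 1)),
          block (-1 - i) (pairCode x i ++ [c])⟩
  | post {i : ℕ} {c : Bool} (hi : i < y.length) (hc : y[i]? = some c) (hA : AgreeUpTo A y x i) :
      Reachable A y x (roundsLeft y.length (i + 1) + 4 * y.length + 4)
        ⟨post, y.length + 1, block (i + 1 : ℕ) (y.drop (i + 1)),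
          block (-1 - i) (pairCode x i ++ [xor c (A (pairCode x i))])⟩
  | check {i : ℕ} {c : Bool} (hi : i < y.length) (hc : y[i]? = some c) (hA : AgreeUpTo A y x i) :
      Reachable A y x (roundsLeft y.length (i + 1) + 4 * y.length + 3)
        ⟨check, y.length, block (i + 1 : ℕ) (y.drop (i + 1)),
          block (-1 - i) (pairCode x i ++ [xor c (A (pairCode x i))])⟩
  | halt {h : ℤ} {I Q : ℤ → Cell} (hA : AgreeUpTo A y x y.length) :
      Reachable A y x 0 ⟨halt, h, I, Q⟩

theorem Reachable.congr {A : Oracle} {y x : List Bool} {m : ℕ} {q : Phase} {h h' : ℤ}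
    {I I' Q Q' : ℤ → Cell} (hr : Reachable A y x m ⟨q, h, I, Q⟩) (hh : h = h') (hI : I = I')
    (hQ : Q = Q') : Reachable A y x m ⟨q, h', I', Q'⟩ := by
  subst hh hI hQ
  exact hr

variable {A : Oracle} {y x : List Bool}

theorem length_pairCode_of_eq_cons {i : ℕ} {b : Bool} {w : List Bool}
    (h : pairCode x i = b :: w) : w.length = i + x.length := by
  have := congrArg List.length h
  rw [length_pairCode, List.length_cons] at this
  omega

theorem update_block_drop {i : ℕ} (hi : i < y.length) :
    Function.update (block i (y.drop i)) i blank = block (i + 1 : ℕ) (y.drop (i + 1)) := by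
  rw [List.drop_eq_getElem_cons hi, update_block_first_blank]
  push_cast
  rfl

theorem block_drop_self (y : List Bool) (i : ℕ) :
    block i (y.drop i) i = (y[i]?).elim blank bit := by
  have := block_add i (y.drop i) 0
  simpa using this

/-- Unless the guess is wrong, the computation goes on. -/
theorem Reachable.progress (hxy : x.length = y.length) (hA : AgreeUpTo A y x y.length) {m : ℕ}
    {v : View} (hv : Reachable A y x m v) (hhalt : v.phase ≠ Phase.halt) :
    ∃ v' m', v.Step A v' ∧ m' < m ∧ Reachable A y x m' v' := by
  cases hv with
  | @guess u hu =>
    rcases lt_or_eq_of_le hu.length_le with hlt | heq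
    · obtain ⟨c, hc⟩ := exists_block_eq_bit (p := 0) (i := u.length) (w := y) (by omega) (by omega)
      obtain ⟨t, rfl⟩ := hu
      cases t with
      | nil => simp at hlt
      | cons b t =>
        refine ⟨_, _, .move hc rfl (.guess c b _), ?_,
          (Reachable.guess (u := u ++ [b]) (by simp)).congr (by simp [Move.shift])
          (update_eq_self_of_eq hc).symm ?_⟩
        · simp only [List.length_append, List.length_cons, List.length_nil] at hxy ⊢
          omega
        · rw [← update_block_append]
          simp
    · obtain rfl := hu.eq_of_length heq
      have hI : block 0 y u.length = blank := block_of_ge (by omega)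
      -- The first code is `0x`, so the bit to be added at the left end is `false`; in later rounds
      -- it is `true`.
      refine ⟨_, _, .move hI rfl (.guessed _), ?_,
        (Reachable.ret (i := 0) (b := false) (w := u) (h := u.length - 1) rfl (by omega)
          (fun j hj => absurd hj (by omega)) (by omega) (by omega)).congr
          rfl ?_ ?_⟩
      · rw [hxy]
        omega
      · rw [update_eq_self_of_eq hI]
        rfl
      · rw [Function.update_eq_self]
        rfl
  | @ret i b w h hw hi hAi h1 h2 =>
    have hlen := length_pairCode_of_eq_cons hw
    rcases h1.lt_or_eq with hlt | rfl
    · obtain ⟨c, hc⟩ := exists_block_eq_bit (p := -1 - i + 1) (i := h) (w := w) (by omega)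
        (by omega)
      refine ⟨_, _, .move rfl hc (.ret b c _), ?_,
        (Reachable.ret (h := h - 1) hw hi hAi (by omega) (by omega)).congr rfl
          (Function.update_eq_self _ _).symm (update_eq_self_of_eq hc).symm⟩
      omega
    · refine ⟨_, _, .move rfl (block_of_lt w (by omega)) (.extend b _), ?_,
        (Reachable.find (h := -i) hi hAi (by omega) (by omega)).congr ?_
          (Function.update_eq_self _ _).symm ?_⟩
      · omega
      · simp only [Move.shift]
        ring
      · rw [update_block_cons, hw]
  | @find i h hi hAi h1 h2 =>
    rcases h2.lt_or_eq with hlt | rfl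
    · have hI : block i (y.drop i) h = blank := block_of_lt _ hlt
      obtain ⟨c, hc⟩ := exists_block_eq_bit (p := -1 - i) (i := h) (w := pairCode x i) (by omega)
        (by rw [length_pairCode]; push_cast; omega)
      refine ⟨_, _, .move hI hc (.skip c), ?_,
        (Reachable.find (h := h + 1) hi hAi (by omega) (by omega)).congr rfl
          (update_eq_self_of_eq hI).symm (update_eq_self_of_eq hc).symm⟩
      omega
    · rcases hi.lt_or_eq with hlt | rfl
      · have hI : block i (y.drop i) i = bit y[i] := by
          rw [block_drop_self, List.getElem?_eq_getElem hlt]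
          rfl
        refine ⟨_, _, .move hI rfl (.hit _ _), ?_,
          (Reachable.carry (h := i + 1) hlt (List.getElem?_eq_getElem hlt) hAi (by omega)
            (by omega)).congr rfl (update_block_drop hlt).symm (Function.update_eq_self _ _).symm⟩
        rw [roundsLeft_eq hlt]
        omega
      · have hI : block y.length (y.drop y.length) y.length = blank := by
          rw [block_drop_self, List.getElem?_eq_none le_rfl]
          rfl
        -- The input is used up and the head has just passed the code. Both tracks are blank here,
        -- which is how the machine recognises the end.
        have hQ : block (-1 - y.length) (pairCode x y.length) y.length = blank :=
          block_of_ge (by rw [length_pairCode]; push_cast; omega)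
        exact ⟨_, _, .move hI hQ .done, by omega, .halt hA⟩
  | @carry i c h hi hc hAi h1 h2 =>
    rcases h2.lt_or_eq with hlt | rfl
    · obtain ⟨b, hb⟩ := exists_block_eq_bit (p := -1 - i) (i := h) (w := pairCode x i) (by omega)
        (by rw [length_pairCode]; push_cast; omega)
      refine ⟨_, _, .move rfl hb (.carry c b _), ?_,
        (Reachable.carry (h := h + 1) hi hc hAi (by omega) (by omega)).congr rfl
          (Function.update_eq_self _ _).symm (update_eq_self_of_eq hb).symm⟩
      omega
    · have hend : (y.length : ℤ) = -1 - i + (pairCode x i).length := by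
        rw [length_pairCode]
        push_cast
        omega
      refine ⟨_, _, .move rfl (block_of_ge hend.ge) (.write c _), ?_,
        (Reachable.pre hi hc hAi).congr rfl (Function.update_eq_self _ _).symm ?_⟩
      · omega
      · rw [hend, update_block_append]
  | @pre i c hi hc hAi => exact ⟨_, _, .call rfl, by omega, .post hi hc hAi⟩
  | @post i c hi hc hAi =>
    refine ⟨_, _, .move rfl rfl (.turn _ _), ?_, (Reachable.check hi hc hAi).congr ?_
      (Function.update_eq_self _ _).symm (Function.update_eq_self _ _).symm⟩
    · omega
    · simp [Move.shift]
  | @check i c hi hc hAi =>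
    have hend : (y.length : ℤ) = -1 - i + (pairCode x i).length := by
      rw [length_pairCode]
      push_cast
      omega
    -- The call leaves `c ⊕ A(x, i)` in the target cell, which is `0` exactly when this bit of the
    -- guess agrees with the input.
    have hcA : c = A (pairCode x i) := Option.some_inj.1 (hc.symm.trans (hA i hi))
    have hQ : block (-1 - i) (pairCode x i ++ [xor c (A (pairCode x i))]) y.length = bit false := by
      rw [hend, block_add_of_lt _ (by simp)]
      simp [hcA]
    refine ⟨_, _, .move rfl hQ (.check _), ?_,
      (Reachable.ret (i := i + 1) (b := true) (w := pairCode x i) (h := y.length - 1) rfl hi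
        (fun j hj => ?_) (by omega) (by omega)).congr rfl (Function.update_eq_self _ _).symm ?_⟩
    · omega
    · exact hA j (by omega)
    · rw [hend, update_block_last_blank]
      congr 1
      push_cast
      ring
  | halt => exact absurd rfl hhalt

/-- The computation does not leave the situations that have been described. -/
theorem Reachable.step (hxy : x.length = y.length) {m : ℕ} {v v' : View}
    (hv : Reachable A y x m v) (hs : v.Step A v') :
    ∃ x' m', x'.length = y.length ∧ Reachable A y x' m' v' := by
  cases hv with
  | @guess u hu =>
    cases hs with
    | move hI hQ hR =>
      cases hR with
      | guess c b =>
        have hlt : u.length < y.length := by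
          by_contra hge
          rw [block_of_ge (by omega)] at hI
          cases hI
        -- The bit just guessed need not be the next bit of `x`. Any string of the right length that
        -- extends the new prefix can take its place; the padding is arbitrary.
        refine ⟨u ++ [b] ++ List.replicate (y.length - (u.length + 1)) true, _, ?_,
          (Reachable.guess (u := u ++ [b]) (List.prefix_append _ _)).congr (by simp [Move.shift])
          (update_eq_self_of_eq hI).symm ?_⟩
        · simp
          omega
        · rw [← update_block_append]
          simp
      | guessed =>
        have hge : y.length ≤ u.length := by
          rcases block_eq_blank_iff.1 hI with h | h <;> omega
        obtain rfl := hu.eq_of_length (le_antisymm hu.length_le (by omega))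
        refine ⟨u, _, hxy,
          (Reachable.ret (i := 0) (b := false) (w := u) (h := u.length - 1) rfl (by omega)
            (fun j hj => absurd hj (by omega)) (by omega) (by omega)).congr
            rfl ?_ ?_⟩
        · rw [update_eq_self_of_eq hI]
          rfl
        · rw [update_eq_self_of_eq hQ]
          rfl
  | @ret i b w h hw hi hAi h1 h2 =>
    have hlen := length_pairCode_of_eq_cons hw
    cases hs with
    | move hI hQ hR =>
      cases hR with
      | ret _ c =>
        have hlt : -1 - i < h := by
          by_contra hge
          rw [block_of_lt _ (by omega)] at hQ
          cases hQ
        exact ⟨x, _, hxy, (Reachable.ret (h := h - 1) hw hi hAi (by omega) (by omega)).congr rfl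
          (update_eq_self_of_eq hI).symm (update_eq_self_of_eq hQ).symm⟩
      | extend =>
        obtain rfl : h = -1 - i := by
          rcases block_eq_blank_iff.1 hQ with h | h <;> omega
        refine ⟨x, _, hxy, (Reachable.find (h := -i) hi hAi (by omega) (by omega)).congr ?_
          (update_eq_self_of_eq hI).symm ?_⟩
        · simp only [Move.shift]
          ring
        · rw [update_block_cons, hw]
  | @find i h hi hAi h1 h2 =>
    have hlen := length_pairCode x i
    cases hs with
    | move hI hQ hR =>
      cases hR with
      | skip c =>
        have hlt : h < i := by
          by_contra hge
          obtain rfl : h = i := by omega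
          have h3 : y.length ≤ i := by
            rcases block_eq_blank_iff.1 hI with h | h
            · omega
            · rw [List.length_drop] at h
              omega
          rw [block_of_ge (by omega)] at hQ
          cases hQ
        exact ⟨x, _, hxy, (Reachable.find (h := h + 1) hi hAi (by omega) (by omega)).congr rfl
          (update_eq_self_of_eq hI).symm (update_eq_self_of_eq hQ).symm⟩
      | hit c =>
        obtain rfl : h = i := by
          by_contra hne
          rw [block_of_lt _ (by omega)] at hI
          cases hI
        have hc : y[i]? = some c := by
          rw [block_drop_self] at hI
          cases hy : y[i]? with
          | none => rw [hy] at hI; cases hI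
          | some b => rw [hy] at hI; cases hI; rfl
        have hlt : i < y.length := (List.getElem?_eq_some_iff.1 hc).1
        exact ⟨x, _, hxy, (Reachable.carry (h := i + 1) hlt hc hAi (by omega) (by omega)).congr rfl
          (update_block_drop hlt).symm (update_eq_self_of_eq hQ).symm⟩
      | done =>
        -- For `-i ≤ h ≤ i ≤ n`, a blank query cell forces `h = n`, hence `i = n`: the machine
        -- cannot halt before all bits have been compared.
        have hin : i = y.length := by
          have h3 := block_eq_blank_iff.1 hI
          have h4 := block_eq_blank_iff.1 hQ
          rw [List.length_drop] at h3
          omega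
        exact ⟨x, _, hxy, .halt (hin ▸ hAi)⟩
  | @carry i c h hi hc hAi h1 h2 =>
    have hlen := length_pairCode x i
    cases hs with
    | move hI hQ hR =>
      cases hR with
      | carry _ b =>
        have hlt : h < y.length := by
          by_contra hge
          rw [block_of_ge (by omega)] at hQ
          cases hQ
        exact ⟨x, _, hxy, (Reachable.carry (h := h + 1) hi hc hAi (by omega) (by omega)).congr rfl
          (update_eq_self_of_eq hI).symm (update_eq_self_of_eq hQ).symm⟩
      | write =>
        have hend : h = -1 - i + (pairCode x i).length := by
          rcases block_eq_blank_iff.1 hQ with h | h <;> omega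
        refine ⟨x, _, hxy, (Reachable.pre hi hc hAi).congr ?_ (update_eq_self_of_eq hI).symm ?_⟩
        · simp only [Move.shift]
          omega
        · rw [hend, update_block_append]
  | @pre i c hi hc hAi =>
    cases hs with
    | call hQ =>
      obtain ⟨rfl, hw⟩ := block_injective (by simp) hQ
      obtain ⟨rfl, hb⟩ := List.append_inj' hw rfl
      obtain rfl : c = _ := by simpa using hb
      exact ⟨x, _, hxy, .post hi hc hAi⟩
    | move hI hQ hR => cases hR
  | @post i c hi hc hAi =>
    cases hs with
    | move hI hQ hR =>
      cases hR with
      | turn =>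
        refine ⟨x, _, hxy, (Reachable.check hi hc hAi).congr ?_
          (update_eq_self_of_eq hI).symm (update_eq_self_of_eq hQ).symm⟩
        simp [Move.shift]
  | @check i c hi hc hAi =>
    have hend : (y.length : ℤ) = -1 - i + (pairCode x i).length := by
      rw [length_pairCode]
      push_cast
      omega
    cases hs with
    | move hI hQ hR =>
      cases hR with
      | check =>
        have hcA : c = A (pairCode x i) := by
          rw [hend, block_add_of_lt _ (by simp)] at hQ
          simpa using hQ
        refine ⟨x, _, hxy, (Reachable.ret (i := i + 1) (b := true) (w := pairCode x i)
          (h := y.length - 1) rfl hi (fun j hj => ?_) (by omega) (by omega)).congr rfl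
          (update_eq_self_of_eq hI).symm ?_⟩
        · rcases Nat.lt_succ_iff_lt_or_eq.1 hj with hj | rfl
          · exact hAi j hj
          · rw [hc, hcA]
        · rw [hend, update_block_last_blank]
          congr 1
          push_cast
          ring
  | halt =>
    cases hs with
    | move hI hQ hR => cases hR

/-! ### From single steps to whole computations -/

theorem Reachable.exists_query_eq {m : ℕ} {v : View} (hv : Reachable A y x m v)
    (hpre : v.phase = Phase.pre) : ∃ p x b, v.query = block p (x ++ [b]) := by
  cases hv <;> first | exact ⟨_, _, _, rfl⟩ | cases hpre

theorem view_phase_eq_halt_iff {c : Config machine.k machine.s} :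
    (view c).phase = halt ↔ c.state = machine.halt :=
  code.symm_apply_eq

/-- The index `m` drops strictly with every step of `Reachable.progress`, so it bounds the number of
steps until halting. -/
theorem Reachable.exists_reachesIn (hxy : x.length = y.length) (hA : AgreeUpTo A y x y.length)
    {m : ℕ} {c : Config machine.k machine.s} (hc : Reachable A y x m (view c)) :
    ∃ t ≤ m, ∃ d, machine.ReachesIn A t c d ∧ d.state = machine.halt := by
  induction m using Nat.strong_induction_on generalizing c with
  | _ m ih =>
    by_cases hhalt : (view c).phase = Phase.halt
    · exact ⟨0, Nat.zero_le _, c, rfl, view_phase_eq_halt_iff.1 hhalt⟩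
    · obtain ⟨v', m', hs, hm, hv'⟩ := hc.progress hxy hA hhalt
      obtain ⟨c', hcc', rfl⟩ := exists_step hs
      obtain ⟨t, ht, d, hd, hdh⟩ := ih m' hm hv'
      exact ⟨t + 1, by omega, d, ⟨c', hcc', hd⟩, hdh⟩

theorem Reachable.of_reachesIn (hxy : x.length = y.length) {m t : ℕ}
    {c d : Config machine.k machine.s} (hc : Reachable A y x m (view c))
    (h : machine.ReachesIn A t c d) :
    ∃ x' m', x'.length = y.length ∧ Reachable A y x' m' (view d) := by
  induction t generalizing c x m with
  | zero =>
    obtain rfl : c = d := h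
    exact ⟨x, m, hxy, hc⟩
  | succ t ih =>
    obtain ⟨e, he, hed⟩ := h
    obtain ⟨x', m', hx', he'⟩ := hc.step hxy (step_view he hc.exists_query_eq)
    exact ih hx' he' hed

theorem reachable_init (A : Oracle) (y x : List Bool) :
    Reachable A y x (roundsLeft y.length 0 + y.length + y.length + 3)
      (view (Config.init machine.k machine.start y)) := by
  rw [view_init]
  exact Reachable.guess List.nil_prefix

end RangeMachine

open RangeMachine in
theorem rangeLanguage_mem_NP (A : Oracle) : rangeLanguage A ∈ NP A := by
  refine ⟨machine, 5 * Polynomial.X ^ 2 + 8 * Polynomial.X + 3, ?_, ?_⟩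
  · rintro y ⟨x, hx⟩
    have hxy : x.length = y.length := by rw [← hx, length_lengthPreserving]
    obtain ⟨t, ht, d, hd, hdh⟩ :=
      (reachable_init A y x).exists_reachesIn hxy ((lengthPreserving_eq_iff hxy).1 hx)
    refine ⟨t, ht.trans_eq ?_, d, hd, hdh⟩
    simp only [roundsLeft, Polynomial.eval_add, Polynomial.eval_mul, Polynomial.eval_pow,
      Polynomial.eval_X, Polynomial.eval_ofNat, Nat.sub_zero]
    ring
  · rintro y hy t ⟨d, hd, hdh⟩
    -- Nothing has been guessed at the start, so any string of length `|y|` can stand in for the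
    -- guess, for instance `y` itself. The actual guess is the `x` obtained here.
    obtain ⟨x, m, hxy, hr⟩ := (reachable_init A y y).of_reachesIn rfl hd
    refine hy ⟨x, (lengthPreserving_eq_iff hxy).2 ?_⟩
    have hphase := view_phase_eq_halt_iff.2 hdh
    generalize view d = v at hr hphase
    cases hr <;> first | assumption | cases hphase

end OracleQuantum

theorem theorem3p5 (T : ℕ → ℝ)
    (hT : T =o[atTop] fun n : ℕ => (2 : ℝ) ^ ((n : ℝ) / 2)) :
    ∀ᵐ A ∂OracleQuantum.randomOracle,
      ¬ (OracleQuantum.NP A ⊆ OracleQuantum.BQTime A T) ∧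
      OracleQuantum.rangeLanguage A ∈ OracleQuantum.NP A ∧
      OracleQuantum.rangeLanguage A ∉ OracleQuantum.BQTime A T := by
  filter_upwards [OracleQuantum.ae_rangeLanguage_notMem_BQTime hT] with A hA
  have hNP := OracleQuantum.rangeLanguage_mem_NP A
  exact ⟨fun h => hA (h hNP), hNP, hA⟩
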